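/- Let $a:[0,1]\times\mathbb R\to\mathbb R$ and $b:[0,1]\times\mathbb R^5\to\mathbb R$ be $C^\infty$-smooth with $a(x,\lambda)>0$ and $b(x,\lambda,0,0,0,0)=0$ for all $x\in[0,1]$, $\lambda\in\mathbb R$. Write $\partial_jb$ for the partial derivative of $b$ in its $j$-th variable, $b_j(x,\lambda):=\partial_jb(x,\lambda,0,0,0,0)$ for $j=3,4,5,6$, and $$b_1:=\tfrac12\Big(-\partial_xa+b_5+\frac{b_6}{a}\Big),\qquad b_2:=\tfrac12\Big(\partial_xa+b_5-\frac{b_6}{a}\Big),$$ $$c_1(x,\xi,\lambda):=\exp\int_x^\xi\frac{b_1(\eta,\lambda)}{a(\eta,\lambda)}d\eta,\quad c_2(x,\xi,\lambda):=\exp\int_\xi^x\frac{b_2(\eta,\lambda)}{a(\eta,\lambda)}d\eta,\quad A(x,\xi,\lambda):=\int_\xi^x\frac{d\eta}{a(\eta,\lambda)}.$$ Let $X:=C_{2\pi}(\mathbb R\times[0,1];\mathbb R^2)$ be the Banach space of all continuous $v=(v_1,v_2):\mathbb R\times[0,1]\to\mathbb R^2$ with $v(t+2\pi,x)=v(t,x)$,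 with the norm $\max_{t,x}(|v_1(t,x)|+|v_2(t,x)|)$. For $\omega,\tau,\lambda\in\mathbb R$ let $\mathcal C(\omega,\lambda)$ and $\mathcal D(\omega,\lambda)$ be the bounded linear operators on $X$ with components $$[\mathcal C_1v](t,x)=-c_1(x,0,\lambda)\,v_2(t+\omega A(x,0,\lambda),0),\qquad [\mathcal C_2v](t,x)=c_2(x,1,\lambda)\,v_1(t-\omega A(x,1,\lambda),1),$$ $$[\mathcal D_1v](t,x)=-\int_0^x\frac{c_1(x,\xi,\lambda)}{a(\xi,\lambda)}v_1(t+\omega A(x,\xi,\lambda),\xi)\,d\xi,\qquad [\mathcal D_2v](t,x)=\int_x^1\frac{c_2(x,\xi,\lambda)}{a(\xi,\lambda)}v_2(t-\omega A(x,\xi,\lambda),\xi)\,d\xi,$$ and let $\mathcal B(\cdot,\omega,\tau,\lambda):X\to X$ be the nonlinear operator with components $[\mathcal B_j(v,\omega,\tau,\lambda)](t,x)=[B(v,\omega,\tau,\lambda)](t,x)-b_j(x,\lambda)v_j(t,x)$, $j=1,2$, where $$[B(v,\omega,\tau,\lambda)](t,x)=b\Big(x,\lambda,[J_\lambda v](t,x),[J_\lambda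 v](t-\omega\tau,x),\tfrac{v_1(t,x)+v_2(t,x)}2,\tfrac{v_1(t,x)-v_2(t,x)}{2a(x,\lambda)}\Big)-\tfrac12\partial_xa(x,\lambda)\,(v_1(t,x)-v_2(t,x)),$$ $$[J_\lambda v](t,x)=\frac12\int_0^x\frac{v_1(t,\xi)-v_2(t,\xi)}{a(\xi,\lambda)}\,d\xi.$$ **Lemma.** Suppose that $\displaystyle\int_0^1\frac{b_5(x,0)}{a(x,0)}\,dx\neq0$. Then there exists $\delta>0$ such that for all $\omega,\tau,\lambda\in\mathbb R$ with $\omega\neq0$ and $|\lambda|<\delta$ the operator $\mathcal B(\cdot,\omega,\tau,\lambda)$ is Fréchet differentiable at $v=0$ and, with $\partial_v\mathcal B(0,\omega,\tau,\lambda)$ denoting its Fréchet derivative there, the operator $$I-\mathcal C(\omega,\lambda)-\mathcal D(\omega,\lambda)\,\partial_v\mathcal B(0,\omega,\tau,\lambda)$$ is a Fredholm operator of index zero from $X$ into itself. -/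

import Mathlib

noncomputable section

open Set
open scoped BoundedContinuousFunction

namespace WaveHopf

/-- The data of the wave equation: smooth functions `a` on `[0,1] × ℝ` and `b` on `[0,1] × ℝ⁵`
(only their values for `x ∈ [0,1]` matter), with `a > 0` and `b(x,l,0,0,0,0) = 0`. -/
structure WaveData where
  a : ℝ → ℝ → ℝ
  b : ℝ → ℝ → ℝ → ℝ → ℝ → ℝ → ℝ
  a_smooth : ContDiffOn ℝ ((⊤ : ℕ∞) : WithTop ℕ∞) (fun p : ℝ × ℝ => a p.1 p.2) (Icc (0 : ℝ) 1 ×ˢ univ)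
  b_smooth : ContDiffOn ℝ ((⊤ : ℕ∞) : WithTop ℕ∞)
    (fun p : ℝ × ℝ × ℝ × ℝ × ℝ × ℝ =>
      b p.1 p.2.1 p.2.2.1 p.2.2.2.1 p.2.2.2.2.1 p.2.2.2.2.2) (Icc (0 : ℝ) 1 ×ˢ univ)
  a_pos : ∀ x ∈ Icc (0 : ℝ) 1, ∀ l : ℝ, 0 < a x l
  b_zero : ∀ x ∈ Icc (0 : ℝ) 1, ∀ l : ℝ, b x l 0 0 0 0 = 0

/-- The space of all continuous `v : ℝ × [0,1] → ℝ²`, `2π`-periodic in the first variable `t`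
(such functions are automatically bounded, see `mkPer`), with the norm
`sup (|v₁(t,x)| + |v₂(t,x)|)`. -/
def periodicSubmodule :
    Submodule ℝ ((ℝ × Icc (0 : ℝ) 1) →ᵇ WithLp 1 (ℝ × ℝ)) where
  carrier := {v | ∀ t x, v (t + 2 * Real.pi, x) = v (t, x)}
  add_mem' := by
    intro v w hv hw t x
    simp [hv t x, hw t x]
  zero_mem' := by
    intro t x
    rfl
  smul_mem' := by
    intro r v hv t x
    simp [hv t x]

def C2pi : Type := periodicSubmodule

instance : NormedAddCommGroup C2pi := inferInstanceAs (NormedAddCommGroup periodicSubmodule)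

instance : NormedSpace ℝ C2pi := inferInstanceAs (NormedSpace ℝ periodicSubmodule)

/-- The first component `v₁(t,x)`. The variable `x` is clamped to `[0,1]`, so that it may be an
integration variable; it is only used for `x ∈ [0,1]`. -/
def fstC (v : C2pi) (t x : ℝ) : ℝ := (v.1 (t, projIcc (0 : ℝ) 1 zero_le_one x)).fst

/-- The second component `v₂(t,x)`, with `x` clamped to `[0,1]`. -/
def sndC (v : C2pi) (t x : ℝ) : ℝ := (v.1 (t, projIcc (0 : ℝ) 1 zero_le_one x)).snd

/-- The domain `ℝ × [0,1]`. -/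
abbrev strip : Set (ℝ × ℝ) := univ ×ˢ Icc (0 : ℝ) 1

/-- The element `(t,x) ↦ (f t x, g t x)` of `C2pi`. -/
def mkPer (f g : ℝ → ℝ → ℝ)
    (hf : ContinuousOn (fun p : ℝ × ℝ => f p.1 p.2) strip)
    (hg : ContinuousOn (fun p : ℝ × ℝ => g p.1 p.2) strip)
    (pf : ∀ t, ∀ x ∈ Icc (0 : ℝ) 1, f (t + 2 * Real.pi) x = f t x)
    (pg : ∀ t, ∀ x ∈ Icc (0 : ℝ) 1, g (t + 2 * Real.pi) x = g t x) : C2pi :=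
  let F : C(ℝ × Icc (0 : ℝ) 1, WithLp 1 (ℝ × ℝ)) :=
    { toFun := fun p => WithLp.toLp 1 (f p.1 p.2, g p.1 p.2)
      continuous_toFun := by
        have h : Continuous fun p : ℝ × Icc (0 : ℝ) 1 => (p.1, (p.2 : ℝ)) := by fun_prop
        refine (WithLp.prod_continuous_toLp 1 ℝ ℝ).comp (Continuous.prodMk ?_ ?_)
        · exact hf.comp_continuous h (fun p => ⟨mem_univ _, p.2.2⟩)
        · exact hg.comp_continuous h (fun p => ⟨mem_univ _, p.2.2⟩) }
  have per : ∀ t x, F (t + 2 * Real.pi, x) = F (t, x) := fun t x => by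
    change WithLp.toLp 1 (f (t + 2 * Real.pi) x, g (t + 2 * Real.pi) x) =
      WithLp.toLp 1 (f t x, g t x)
    rw [pf t x x.2, pg t x x.2]
  have bd : ∃ c, ∀ p q, dist (F p) (F q) ≤ c := by
    have hK : IsCompact (F '' (Icc 0 (2 * Real.pi) ×ˢ univ)) :=
      (isCompact_Icc.prod isCompact_univ).image F.continuous
    obtain ⟨c, hc⟩ := Metric.isBounded_iff.1 hK.isBounded
    have mem : ∀ p, F p ∈ F '' (Icc 0 (2 * Real.pi) ×ˢ univ) := by
      rintro ⟨t, x⟩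
      have hp : Function.Periodic (fun s => F (s, x)) (2 * Real.pi) := fun s => per s x
      obtain ⟨s, hs, h⟩ := hp.exists_mem_Ico₀ Real.two_pi_pos t
      exact ⟨(s, x), ⟨Ico_subset_Icc_self hs, mem_univ _⟩, h.symm⟩
    exact ⟨c, fun p q => hc (mem p) (mem q)⟩
  ⟨BoundedContinuousFunction.mkOfBound F bd.choose bd.choose_spec, per⟩

namespace WaveData

variable (W : WaveData)

/-! ### Partial derivatives and coefficient functions -/

/-- `∂ₓ a(x,l)`, one-sided at `x = 0, 1`. -/
def ax (x l : ℝ) : ℝ := derivWithin (fun y => W.a y l) (Icc (0 : ℝ) 1) x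

def b₃ (x l : ℝ) : ℝ := deriv (fun s => W.b x l s 0 0 0) 0

def b₄ (x l : ℝ) : ℝ := deriv (fun s => W.b x l 0 s 0 0) 0

def b₅ (x l : ℝ) : ℝ := deriv (fun s => W.b x l 0 0 s 0) 0

def b₆ (x l : ℝ) : ℝ := deriv (fun s => W.b x l 0 0 0 s) 0

def b₁ (x l : ℝ) : ℝ := (1 / 2) * (-W.ax x l + W.b₅ x l + W.b₆ x l / W.a x l)

def b₂ (x l : ℝ) : ℝ := (1 / 2) * (W.ax x l + W.b₅ x l - W.b₆ x l / W.a x l)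

def c₁ (x ξ l : ℝ) : ℝ := Real.exp (∫ η in x..ξ, W.b₁ η l / W.a η l)

def c₂ (x ξ l : ℝ) : ℝ := Real.exp (∫ η in ξ..x, W.b₂ η l / W.a η l)

def A (x ξ l : ℝ) : ℝ := ∫ η in ξ..x, 1 / W.a η l

/-! ### Pointwise formulas of the operators -/

def J (l : ℝ) (v : C2pi) (t x : ℝ) : ℝ :=
  (1 / 2) * ∫ ξ in (0 : ℝ)..x, (fstC v t ξ - sndC v t ξ) / W.a ξ l

def K₀ (v : C2pi) (t x : ℝ) : ℝ := (fstC v t x + sndC v t x) / 2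

def K (l : ℝ) (v : C2pi) (t x : ℝ) : ℝ := (fstC v t x - sndC v t x) / (2 * W.a x l)

/-- The nonlinearity of the first-order system. -/
def B (v : C2pi) (ω τ l t x : ℝ) : ℝ :=
  W.b x l (W.J l v t x) (W.J l v (t - ω * τ) x) (K₀ v t x) (W.K l v t x)
    - (1 / 2) * W.ax x l * (fstC v t x - sndC v t x)

def B₁ (v : C2pi) (ω τ l t x : ℝ) : ℝ := W.B v ω τ l t x - W.b₁ x l * fstC v t x

def B₂ (v : C2pi) (ω τ l t x : ℝ) : ℝ := W.B v ω τ l t x - W.b₂ x l * sndC v t x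

def C₁ (ω l : ℝ) (v : C2pi) (t x : ℝ) : ℝ :=
  -W.c₁ x 0 l * sndC v (t + ω * W.A x 0 l) 0

def C₂ (ω l : ℝ) (v : C2pi) (t x : ℝ) : ℝ :=
  W.c₂ x 1 l * fstC v (t - ω * W.A x 1 l) 1

def D₁ (ω l : ℝ) (v : C2pi) (t x : ℝ) : ℝ :=
  -∫ ξ in (0 : ℝ)..x, W.c₁ x ξ l / W.a ξ l * fstC v (t + ω * W.A x ξ l) ξ

def D₂ (ω l : ℝ) (v : C2pi) (t x : ℝ) : ℝ :=
  ∫ ξ in x..(1 : ℝ), W.c₂ x ξ l / W.a ξ l * sndC v (t - ω * W.A x ξ l) ξ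

end WaveData

/-! ### Continuity facts needed for the operators to be well defined -/

lemma fstC_continuous (v : C2pi) : Continuous fun p : ℝ × ℝ => fstC v p.1 p.2 :=
  (WithLp.continuous_fst 1 ℝ ℝ).comp (v.1.continuous.comp
    (continuous_fst.prodMk (continuous_projIcc.comp continuous_snd)))

lemma sndC_continuous (v : C2pi) : Continuous fun p : ℝ × ℝ => sndC v p.1 p.2 :=
  (WithLp.continuous_snd 1 ℝ ℝ).comp (v.1.continuous.comp
    (continuous_fst.prodMk (continuous_projIcc.comp continuous_snd)))

lemma fstC_per (v : C2pi) (t x : ℝ) : fstC v (t + 2 * Real.pi) x = fstC v t x := by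
  unfold fstC; rw [v.2 t _]

lemma sndC_per (v : C2pi) (t x : ℝ) : sndC v (t + 2 * Real.pi) x = sndC v t x := by
  unfold sndC; rw [v.2 t _]

lemma fstC_add (v w : C2pi) (t x : ℝ) : fstC (v + w) t x = fstC v t x + fstC w t x := rfl

lemma sndC_add (v w : C2pi) (t x : ℝ) : sndC (v + w) t x = sndC v t x + sndC w t x := rfl

lemma fstC_smul (r : ℝ) (v : C2pi) (t x : ℝ) : fstC (r • v) t x = r * fstC v t x := rfl

lemma sndC_smul (r : ℝ) (v : C2pi) (t x : ℝ) : sndC (r • v) t x = r * sndC v t x := rfl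

lemma fstC_le (v : C2pi) (t x : ℝ) : |fstC v t x| ≤ ‖v‖ := by
  have h := v.1.norm_coe_le_norm (t, projIcc (0 : ℝ) 1 zero_le_one x)
  rw [WithLp.prod_norm_eq_of_L1] at h
  refine le_trans ?_ h
  exact le_add_of_nonneg_right (norm_nonneg _)

lemma sndC_le (v : C2pi) (t x : ℝ) : |sndC v t x| ≤ ‖v‖ := by
  have h := v.1.norm_coe_le_norm (t, projIcc (0 : ℝ) 1 zero_le_one x)
  rw [WithLp.prod_norm_eq_of_L1] at h
  refine le_trans ?_ h
  exact le_add_of_nonneg_left (norm_nonneg _)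

lemma mkPer_norm_le {f g : ℝ → ℝ → ℝ} {hf hg pf pg} {M : ℝ}
    (h1 : ∀ t, ∀ x ∈ Icc (0 : ℝ) 1, |f t x| ≤ M) (h2 : ∀ t, ∀ x ∈ Icc (0 : ℝ) 1, |g t x| ≤ M) :
    ‖mkPer f g hf hg pf pg‖ ≤ 2 * M := by
  have hM : 0 ≤ M := (abs_nonneg _).trans (h1 0 0 (by simp))
  change ‖(mkPer f g hf hg pf pg).1‖ ≤ _
  rw [BoundedContinuousFunction.norm_le (by positivity)]
  rintro ⟨t, x⟩
  rw [WithLp.prod_norm_eq_of_L1, two_mul]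
  exact add_le_add (h1 t x x.2) (h2 t x x.2)

lemma mkPer_add {f g f' g' f'' g'' : ℝ → ℝ → ℝ} {hf hg pf pg hf' hg' pf' pg' hf'' hg'' pf'' pg''}
    (h1 : ∀ t, ∀ x ∈ Icc (0 : ℝ) 1, f t x = f' t x + f'' t x)
    (h2 : ∀ t, ∀ x ∈ Icc (0 : ℝ) 1, g t x = g' t x + g'' t x) :
    mkPer f g hf hg pf pg = mkPer f' g' hf' hg' pf' pg' + mkPer f'' g'' hf'' hg'' pf'' pg'' := by
  apply Subtype.ext
  ext1 ⟨t, x⟩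
  change WithLp.toLp 1 (f t x, g t x) =
    WithLp.toLp 1 (f' t x, g' t x) + WithLp.toLp 1 (f'' t x, g'' t x)
  rw [h1 t x x.2, h2 t x x.2]
  rfl

lemma mkPer_smul {f g f' g' : ℝ → ℝ → ℝ} {hf hg pf pg hf' hg' pf' pg'} {r : ℝ}
    (h1 : ∀ t, ∀ x ∈ Icc (0 : ℝ) 1, f t x = r * f' t x)
    (h2 : ∀ t, ∀ x ∈ Icc (0 : ℝ) 1, g t x = r * g' t x) :
    mkPer f g hf hg pf pg = r • mkPer f' g' hf' hg' pf' pg' := by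
  apply Subtype.ext
  ext1 ⟨t, x⟩
  change WithLp.toLp 1 (f t x, g t x) = r • WithLp.toLp 1 (f' t x, g' t x)
  rw [h1 t x x.2, h2 t x x.2]
  rfl

/-- A parameter-dependent primitive is continuous on the strip. -/
lemma continuousOn_integral {h : ℝ → ℝ → ℝ → ℝ}
    (hh : ContinuousOn (fun p : ℝ × ℝ × ℝ => h p.1 p.2.1 p.2.2)
      (univ ×ˢ Icc (0 : ℝ) 1 ×ˢ Icc (0 : ℝ) 1)) {c : ℝ} (hc : c ∈ Icc (0 : ℝ) 1) :
    ContinuousOn (fun p : ℝ × ℝ => ∫ ξ in c..p.2, h p.1 p.2 ξ) strip := by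
  have key : Continuous fun p : ℝ × ℝ => ∫ ξ in c..p.2,
      h p.1 (projIcc (0 : ℝ) 1 zero_le_one p.2) (projIcc (0 : ℝ) 1 zero_le_one ξ) := by
    refine intervalIntegral.continuous_parametric_intervalIntegral_of_continuous
      (f := fun (p : ℝ × ℝ) ξ => h p.1 (projIcc (0 : ℝ) 1 zero_le_one p.2)
        (projIcc (0 : ℝ) 1 zero_le_one ξ)) ?_ continuous_snd
    refine hh.comp_continuous (f := fun q : (ℝ × ℝ) × ℝ =>
      (q.1.1, ((projIcc (0 : ℝ) 1 zero_le_one q.1.2 : Icc (0 : ℝ) 1) : ℝ),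
        ((projIcc (0 : ℝ) 1 zero_le_one q.2 : Icc (0 : ℝ) 1) : ℝ))) ?_ ?_
    · exact (continuous_fst.comp continuous_fst).prodMk
        ((continuous_subtype_val.comp (continuous_projIcc.comp
          (continuous_snd.comp continuous_fst))).prodMk
          (continuous_subtype_val.comp (continuous_projIcc.comp continuous_snd)))
    · intro q
      exact ⟨mem_univ _, Subtype.prop _, Subtype.prop _⟩
  refine key.continuousOn.congr ?_
  rintro ⟨t, x⟩ ⟨-, hx⟩
  refine intervalIntegral.integral_congr ?_
  intro ξ hξ
  have hξ' : ξ ∈ Icc (0 : ℝ) 1 := uIcc_subset_Icc hc hx hξ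
  have e1 := projIcc_of_mem zero_le_one hx
  have e2 := projIcc_of_mem zero_le_one hξ'
  simp only [e1, e2]

/-- Integrals of functions continuous on `[0,1]` are jointly continuous in both bounds. -/
lemma continuousOn_integral₂ {g : ℝ → ℝ} (hg : ContinuousOn g (Icc (0 : ℝ) 1)) :
    ContinuousOn (fun p : ℝ × ℝ => ∫ η in p.1..p.2, g η) (Icc (0 : ℝ) 1 ×ˢ Icc (0 : ℝ) 1) := by
  have hF : ContinuousOn (fun x => ∫ η in (0 : ℝ)..x, g η) (Icc (0 : ℝ) 1) := by
    have h := continuousOn_integral (h := fun _ _ ξ => g ξ) (c := 0)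
      (hg.comp (by fun_prop) (fun p hp => hp.2.2)) (by simp)
    exact h.comp (f := fun x : ℝ => ((0 : ℝ), x)) (by fun_prop) (fun x hx => ⟨mem_univ _, hx⟩)
  have h2 : ContinuousOn (fun p : ℝ × ℝ => (∫ η in (0 : ℝ)..p.2, g η) - ∫ η in (0 : ℝ)..p.1, g η)
      (Icc (0 : ℝ) 1 ×ˢ Icc (0 : ℝ) 1) :=
    (hF.comp continuousOn_snd (fun p hp => hp.2)).sub
      (hF.comp continuousOn_fst (fun p hp => hp.1))
  refine h2.congr ?_
  rintro ⟨x, y⟩ ⟨hx, hy⟩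
  have z : (0 : ℝ) ∈ Icc (0 : ℝ) 1 := by simp
  refine (intervalIntegral.integral_interval_sub_left ?_ ?_).symm
  · exact (hg.mono (uIcc_subset_Icc z hy)).intervalIntegrable
  · exact (hg.mono (uIcc_subset_Icc z hx)).intervalIntegrable

namespace WaveData

variable (W : WaveData)

lemma a_cont (l : ℝ) : ContinuousOn (fun x => W.a x l) (Icc (0 : ℝ) 1) :=
  W.a_smooth.continuousOn.comp (f := fun x : ℝ => (x, l)) (by fun_prop)
    (fun _ hx => ⟨hx, mem_univ _⟩)

lemma a_ne (l : ℝ) : ∀ x ∈ Icc (0 : ℝ) 1, W.a x l ≠ 0 := fun x hx => (W.a_pos x hx l).ne'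

lemma ax_cont (l : ℝ) : ContinuousOn (fun x => W.ax x l) (Icc (0 : ℝ) 1) := by
  have h : ContDiffOn ℝ ((⊤ : ℕ∞) : WithTop ℕ∞) (fun x => W.a x l) (Icc (0 : ℝ) 1) :=
    W.a_smooth.comp (f := fun x : ℝ => (x, l)) (by fun_prop) (fun _ hx => ⟨hx, mem_univ _⟩)
  exact h.continuousOn_derivWithin (uniqueDiffOn_Icc zero_lt_one) (by simp)

lemma deriv_b_cont (l : ℝ) (e : ℝ × ℝ × ℝ × ℝ) :
    ContinuousOn (fun x => deriv (fun s : ℝ =>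
      W.b x l (s * e.1) (s * e.2.1) (s * e.2.2.1) (s * e.2.2.2)) 0) (Icc (0 : ℝ) 1) := by
  have hu : UniqueDiffOn ℝ (Icc (0 : ℝ) 1 ×ˢ (univ : Set (ℝ × ℝ × ℝ × ℝ × ℝ))) :=
    (uniqueDiffOn_Icc zero_lt_one).prod uniqueDiffOn_univ
  have hd := W.b_smooth.continuousOn_fderivWithin hu (by simp)
  have h2 := (hd.comp (f := fun x : ℝ => (x, l, (0 : ℝ), (0 : ℝ), (0 : ℝ), (0 : ℝ)))
    (s := Icc (0 : ℝ) 1) (by fun_prop) (fun x hx => ⟨hx, mem_univ _⟩)).clm_apply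
    (continuousOn_const (c := ((0 : ℝ), (0 : ℝ), e)))
  refine h2.congr ?_
  intro x hx
  have hdiff := (W.b_smooth.differentiableOn (by simp) (x, l, (0 : ℝ), (0 : ℝ), (0 : ℝ), (0 : ℝ))
    ⟨hx, mem_univ _⟩).hasFDerivWithinAt
  have hline : HasDerivAt (fun s : ℝ => (x, l, s * e.1, s * e.2.1, s * e.2.2.1, s * e.2.2.2))
      ((0 : ℝ), (0 : ℝ), e) 0 := by
    refine (hasDerivAt_const _ _).prodMk ((hasDerivAt_const _ _).prodMk
      (HasDerivAt.prodMk ?_ (HasDerivAt.prodMk ?_ (HasDerivAt.prodMk ?_ ?_)))) <;>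
    exact hasDerivAt_mul_const _
  have := HasFDerivWithinAt.comp_hasDerivAt_of_eq (0 : ℝ) hdiff hline
    (Filter.Eventually.of_forall fun s => ⟨hx, mem_univ _⟩) (by simp)
  exact this.deriv

lemma b₃_cont (l : ℝ) : ContinuousOn (fun x => W.b₃ x l) (Icc (0 : ℝ) 1) := by
  simpa [b₃] using W.deriv_b_cont l (1, 0, 0, 0)

lemma b₄_cont (l : ℝ) : ContinuousOn (fun x => W.b₄ x l) (Icc (0 : ℝ) 1) := by
  simpa [b₄] using W.deriv_b_cont l (0, 1, 0, 0)

lemma b₅_cont (l : ℝ) : ContinuousOn (fun x => W.b₅ x l) (Icc (0 : ℝ) 1) := by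
  simpa [b₅] using W.deriv_b_cont l (0, 0, 1, 0)

lemma b₆_cont (l : ℝ) : ContinuousOn (fun x => W.b₆ x l) (Icc (0 : ℝ) 1) := by
  simpa [b₆] using W.deriv_b_cont l (0, 0, 0, 1)

lemma b₁_cont (l : ℝ) : ContinuousOn (fun x => W.b₁ x l) (Icc (0 : ℝ) 1) :=
  continuousOn_const.mul (((W.ax_cont l).neg.add (W.b₅_cont l)).add
    ((W.b₆_cont l).div (W.a_cont l) (W.a_ne l)))

lemma b₂_cont (l : ℝ) : ContinuousOn (fun x => W.b₂ x l) (Icc (0 : ℝ) 1) :=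
  continuousOn_const.mul (((W.ax_cont l).add (W.b₅_cont l)).sub
    ((W.b₆_cont l).div (W.a_cont l) (W.a_ne l)))

lemma c₁_cont (l : ℝ) :
    ContinuousOn (fun p : ℝ × ℝ => W.c₁ p.1 p.2 l) (Icc (0 : ℝ) 1 ×ˢ Icc (0 : ℝ) 1) :=
  Real.continuous_exp.comp_continuousOn
    (continuousOn_integral₂ ((W.b₁_cont l).div (W.a_cont l) (W.a_ne l)))

lemma c₂_cont (l : ℝ) :
    ContinuousOn (fun p : ℝ × ℝ => W.c₂ p.1 p.2 l) (Icc (0 : ℝ) 1 ×ˢ Icc (0 : ℝ) 1) :=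
  Real.continuous_exp.comp_continuousOn
    ((continuousOn_integral₂ ((W.b₂_cont l).div (W.a_cont l) (W.a_ne l))).comp
      continuous_swap.continuousOn (fun _ hp => ⟨hp.2, hp.1⟩))

lemma A_cont (l : ℝ) :
    ContinuousOn (fun p : ℝ × ℝ => W.A p.1 p.2 l) (Icc (0 : ℝ) 1 ×ˢ Icc (0 : ℝ) 1) :=
  (continuousOn_integral₂ (continuousOn_const.div (W.a_cont l) (W.a_ne l))).comp
    continuous_swap.continuousOn (fun _ hp => ⟨hp.2, hp.1⟩)

lemma J_cont (l : ℝ) (v : C2pi) : ContinuousOn (fun p : ℝ × ℝ => W.J l v p.1 p.2) strip := by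
  refine continuousOn_const.mul
    (continuousOn_integral (h := fun t _ ξ => (fstC v t ξ - sndC v t ξ) / W.a ξ l) ?_ (by simp))
  refine ContinuousOn.div ?_ ((W.a_cont l).comp (by fun_prop) (fun p hp => hp.2.2))
    (fun p hp => W.a_ne l _ hp.2.2)
  exact (((fstC_continuous v).comp (by fun_prop : Continuous fun p : ℝ × ℝ × ℝ =>
    (p.1, p.2.2))).sub ((sndC_continuous v).comp (by fun_prop : Continuous fun p : ℝ × ℝ × ℝ =>
    (p.1, p.2.2)))).continuousOn

lemma J_per (l : ℝ) (v : C2pi) (t x : ℝ) : W.J l v (t + 2 * Real.pi) x = W.J l v t x := by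
  simp only [J, fstC_per, sndC_per]

lemma B_cont (v : C2pi) (ω τ l : ℝ) :
    ContinuousOn (fun p : ℝ × ℝ => W.B v ω τ l p.1 p.2) strip := by
  have f1 := (fstC_continuous v).continuousOn (s := strip)
  have f2 := (sndC_continuous v).continuousOn (s := strip)
  have ha : ContinuousOn (fun p : ℝ × ℝ => W.a p.2 l) strip :=
    (W.a_cont l).comp continuousOn_snd (fun p hp => hp.2)
  have hax : ContinuousOn (fun p : ℝ × ℝ => W.ax p.2 l) strip :=
    (W.ax_cont l).comp continuousOn_snd (fun p hp => hp.2)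
  have hJ := W.J_cont l v
  have hJ' : ContinuousOn (fun p : ℝ × ℝ => W.J l v (p.1 - ω * τ) p.2) strip :=
    hJ.comp (f := fun p : ℝ × ℝ => (p.1 - ω * τ, p.2)) (by fun_prop)
      (fun p hp => ⟨mem_univ _, hp.2⟩)
  have hK : ContinuousOn (fun p : ℝ × ℝ => W.K l v p.1 p.2) strip :=
    (f1.sub f2).div (continuousOn_const.mul ha)
      (fun p hp => mul_ne_zero two_ne_zero (W.a_ne l _ hp.2))
  have hK0 : ContinuousOn (fun p : ℝ × ℝ => K₀ v p.1 p.2) strip :=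
    (f1.add f2).div_const _
  refine ContinuousOn.sub ?_ ((continuousOn_const.mul hax).mul (f1.sub f2))
  exact W.b_smooth.continuousOn.comp
    (f := fun p : ℝ × ℝ => (p.2, l, W.J l v p.1 p.2, W.J l v (p.1 - ω * τ) p.2, K₀ v p.1 p.2,
      W.K l v p.1 p.2))
    (continuousOn_snd.prodMk (continuousOn_const.prodMk (hJ.prodMk (hJ'.prodMk
      (hK0.prodMk hK))))) (fun p hp => ⟨hp.2, mem_univ _⟩)

lemma B_per (v : C2pi) (ω τ l t x : ℝ) :
    W.B v ω τ l (t + 2 * Real.pi) x = W.B v ω τ l t x := by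
  have e : t + 2 * Real.pi - ω * τ = (t - ω * τ) + 2 * Real.pi := by ring
  simp only [B, K, K₀, J_per, fstC_per, sndC_per, e]

lemma C₁_cont (ω l : ℝ) (v : C2pi) :
    ContinuousOn (fun p : ℝ × ℝ => W.C₁ ω l v p.1 p.2) strip := by
  have hm : ∀ p ∈ strip, (p.2, (0 : ℝ)) ∈ Icc (0 : ℝ) 1 ×ˢ Icc (0 : ℝ) 1 :=
    fun p hp => ⟨hp.2, by simp⟩
  have hc : ContinuousOn (fun p : ℝ × ℝ => W.c₁ p.2 0 l) strip :=
    (W.c₁_cont l).comp (f := fun p : ℝ × ℝ => (p.2, (0 : ℝ))) (by fun_prop) hm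
  have hA : ContinuousOn (fun p : ℝ × ℝ => W.A p.2 0 l) strip :=
    (W.A_cont l).comp (f := fun p : ℝ × ℝ => (p.2, (0 : ℝ))) (by fun_prop) hm
  exact hc.neg.mul ((sndC_continuous v).comp_continuousOn
    ((continuousOn_fst.add (continuousOn_const.mul hA)).prodMk continuousOn_const))

lemma C₂_cont (ω l : ℝ) (v : C2pi) :
    ContinuousOn (fun p : ℝ × ℝ => W.C₂ ω l v p.1 p.2) strip := by
  have hm : ∀ p ∈ strip, (p.2, (1 : ℝ)) ∈ Icc (0 : ℝ) 1 ×ˢ Icc (0 : ℝ) 1 :=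
    fun p hp => ⟨hp.2, by simp⟩
  have hc : ContinuousOn (fun p : ℝ × ℝ => W.c₂ p.2 1 l) strip :=
    (W.c₂_cont l).comp (f := fun p : ℝ × ℝ => (p.2, (1 : ℝ))) (by fun_prop) hm
  have hA : ContinuousOn (fun p : ℝ × ℝ => W.A p.2 1 l) strip :=
    (W.A_cont l).comp (f := fun p : ℝ × ℝ => (p.2, (1 : ℝ))) (by fun_prop) hm
  exact hc.mul ((fstC_continuous v).comp_continuousOn
    ((continuousOn_fst.sub (continuousOn_const.mul hA)).prodMk continuousOn_const))

lemma D₁_integrand_cont (ω l : ℝ) (v : C2pi) :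
    ContinuousOn (fun p : ℝ × ℝ × ℝ =>
      W.c₁ p.2.1 p.2.2 l / W.a p.2.2 l * fstC v (p.1 + ω * W.A p.2.1 p.2.2 l) p.2.2)
      (univ ×ˢ Icc (0 : ℝ) 1 ×ˢ Icc (0 : ℝ) 1) := by
  have hc := (W.c₁_cont l).comp (continuousOn_snd (s := (univ : Set ℝ) ×ˢ
    Icc (0 : ℝ) 1 ×ˢ Icc (0 : ℝ) 1)) (fun p hp => hp.2)
  have hA := (W.A_cont l).comp (continuousOn_snd (s := (univ : Set ℝ) ×ˢ
    Icc (0 : ℝ) 1 ×ˢ Icc (0 : ℝ) 1)) (fun p hp => hp.2)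
  refine (hc.div ((W.a_cont l).comp (by fun_prop) (fun p hp => hp.2.2))
    (fun p hp => W.a_ne l _ hp.2.2)).mul ?_
  exact (fstC_continuous v).comp_continuousOn
    ((continuousOn_fst.add (continuousOn_const.mul hA)).prodMk (by fun_prop))

lemma D₂_integrand_cont (ω l : ℝ) (v : C2pi) :
    ContinuousOn (fun p : ℝ × ℝ × ℝ =>
      W.c₂ p.2.1 p.2.2 l / W.a p.2.2 l * sndC v (p.1 - ω * W.A p.2.1 p.2.2 l) p.2.2)
      (univ ×ˢ Icc (0 : ℝ) 1 ×ˢ Icc (0 : ℝ) 1) := by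
  have hc := (W.c₂_cont l).comp (continuousOn_snd (s := (univ : Set ℝ) ×ˢ
    Icc (0 : ℝ) 1 ×ˢ Icc (0 : ℝ) 1)) (fun p hp => hp.2)
  have hA := (W.A_cont l).comp (continuousOn_snd (s := (univ : Set ℝ) ×ˢ
    Icc (0 : ℝ) 1 ×ˢ Icc (0 : ℝ) 1)) (fun p hp => hp.2)
  refine (hc.div ((W.a_cont l).comp (by fun_prop) (fun p hp => hp.2.2))
    (fun p hp => W.a_ne l _ hp.2.2)).mul ?_
  exact (sndC_continuous v).comp_continuousOn
    ((continuousOn_fst.sub (continuousOn_const.mul hA)).prodMk (by fun_prop))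

lemma D₁_integrable (ω l : ℝ) (v : C2pi) (t : ℝ) {x : ℝ} (hx : x ∈ Icc (0 : ℝ) 1) :
    IntervalIntegrable (fun ξ => W.c₁ x ξ l / W.a ξ l * fstC v (t + ω * W.A x ξ l) ξ)
      MeasureTheory.volume 0 x := by
  refine ContinuousOn.intervalIntegrable ?_
  exact (W.D₁_integrand_cont ω l v).comp (f := fun ξ : ℝ => (t, x, ξ)) (by fun_prop)
    (fun ξ hξ => ⟨mem_univ _, hx, uIcc_subset_Icc (by simp) hx hξ⟩)

lemma D₂_integrable (ω l : ℝ) (v : C2pi) (t : ℝ) {x : ℝ} (hx : x ∈ Icc (0 : ℝ) 1) :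
    IntervalIntegrable (fun ξ => W.c₂ x ξ l / W.a ξ l * sndC v (t - ω * W.A x ξ l) ξ)
      MeasureTheory.volume x 1 := by
  refine ContinuousOn.intervalIntegrable ?_
  exact (W.D₂_integrand_cont ω l v).comp (f := fun ξ : ℝ => (t, x, ξ)) (by fun_prop)
    (fun ξ hξ => ⟨mem_univ _, hx, uIcc_subset_Icc hx (by simp) hξ⟩)

lemma D₁_cont (ω l : ℝ) (v : C2pi) :
    ContinuousOn (fun p : ℝ × ℝ => W.D₁ ω l v p.1 p.2) strip :=
  (continuousOn_integral (h := fun t x ξ =>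
    W.c₁ x ξ l / W.a ξ l * fstC v (t + ω * W.A x ξ l) ξ) (W.D₁_integrand_cont ω l v)
    (by simp)).neg

lemma D₂_cont (ω l : ℝ) (v : C2pi) :
    ContinuousOn (fun p : ℝ × ℝ => W.D₂ ω l v p.1 p.2) strip := by
  have h := (continuousOn_integral (c := 1) (h := fun t x ξ =>
    W.c₂ x ξ l / W.a ξ l * sndC v (t - ω * W.A x ξ l) ξ) (W.D₂_integrand_cont ω l v)
    (by simp)).neg
  refine h.congr ?_
  intro p _
  exact intervalIntegral.integral_symm _ _

lemma C₁_per (ω l : ℝ) (v : C2pi) (t x : ℝ) :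
    W.C₁ ω l v (t + 2 * Real.pi) x = W.C₁ ω l v t x := by
  simp only [C₁, add_right_comm t (2 * Real.pi), sndC_per]

lemma C₂_per (ω l : ℝ) (v : C2pi) (t x : ℝ) :
    W.C₂ ω l v (t + 2 * Real.pi) x = W.C₂ ω l v t x := by
  simp only [C₂, add_sub_right_comm t (2 * Real.pi), fstC_per]

lemma D₁_per (ω l : ℝ) (v : C2pi) (t x : ℝ) :
    W.D₁ ω l v (t + 2 * Real.pi) x = W.D₁ ω l v t x := by
  simp only [D₁, add_right_comm t (2 * Real.pi), fstC_per]

lemma D₂_per (ω l : ℝ) (v : C2pi) (t x : ℝ) :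
    W.D₂ ω l v (t + 2 * Real.pi) x = W.D₂ ω l v t x := by
  simp only [D₂, add_sub_right_comm t (2 * Real.pi), sndC_per]

/-! ### The operators on `C2pi` -/

/-- The nonlinear operator `v ↦ (B₁ v, B₂ v)` on `C2pi`. -/
def opB (ω τ l : ℝ) (v : C2pi) : C2pi :=
  mkPer (W.B₁ v ω τ l) (W.B₂ v ω τ l)
    ((W.B_cont v ω τ l).sub (((W.b₁_cont l).comp continuousOn_snd (fun _ hp => hp.2)).mul
      (fstC_continuous v).continuousOn))
    ((W.B_cont v ω τ l).sub (((W.b₂_cont l).comp continuousOn_snd (fun _ hp => hp.2)).mul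
      (sndC_continuous v).continuousOn))
    (fun t x _ => by simp only [B₁, B_per, fstC_per])
    (fun t x _ => by simp only [B₂, B_per, sndC_per])

def opCₗ (ω l : ℝ) : C2pi →ₗ[ℝ] C2pi where
  toFun v := mkPer (W.C₁ ω l v) (W.C₂ ω l v) (W.C₁_cont ω l v) (W.C₂_cont ω l v)
    (fun t x _ => W.C₁_per ω l v t x) (fun t x _ => W.C₂_per ω l v t x)
  map_add' v w := mkPer_add (fun t x _ => by simp only [C₁, sndC_add]; ring)
    (fun t x _ => by simp only [C₂, fstC_add]; ring)
  map_smul' r v := mkPer_smul (fun t x _ => by simp only [C₁, sndC_smul]; simp; ring)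
    (fun t x _ => by simp only [C₂, fstC_smul]; simp; ring)

def opDₗ (ω l : ℝ) : C2pi →ₗ[ℝ] C2pi where
  toFun v := mkPer (W.D₁ ω l v) (W.D₂ ω l v) (W.D₁_cont ω l v) (W.D₂_cont ω l v)
    (fun t x _ => W.D₁_per ω l v t x) (fun t x _ => W.D₂_per ω l v t x)
  map_add' v w := mkPer_add
    (fun t x hx => by
      simp only [D₁, fstC_add, mul_add]
      rw [intervalIntegral.integral_add (W.D₁_integrable ω l v t hx)
        (W.D₁_integrable ω l w t hx), neg_add])
    (fun t x hx => by
      simp only [D₂, sndC_add, mul_add]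
      rw [intervalIntegral.integral_add (W.D₂_integrable ω l v t hx)
        (W.D₂_integrable ω l w t hx)])
  map_smul' r v := mkPer_smul
    (fun t x hx => by
      simp only [D₁, fstC_smul, mul_left_comm _ r, intervalIntegral.integral_const_mul]
      simp)
    (fun t x hx => by
      simp only [D₂, sndC_smul, mul_left_comm _ r, intervalIntegral.integral_const_mul]
      simp)

lemma exists_bound₂ {g : ℝ × ℝ → ℝ}
    (hg : ContinuousOn g (Icc (0 : ℝ) 1 ×ˢ Icc (0 : ℝ) 1)) :
    ∃ M, 0 ≤ M ∧ ∀ x ∈ Icc (0 : ℝ) 1, ∀ ξ ∈ Icc (0 : ℝ) 1, |g (x, ξ)| ≤ M := by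
  obtain ⟨M, hM⟩ := (isCompact_Icc.prod isCompact_Icc).exists_bound_of_continuousOn hg
  exact ⟨M, (norm_nonneg _).trans (hM (0, 0) (by simp)), fun x hx ξ hξ => hM _ ⟨hx, hξ⟩⟩

lemma opC_bound (ω l : ℝ) : ∃ M, ∀ v, ‖W.opCₗ ω l v‖ ≤ M * ‖v‖ := by
  obtain ⟨M, hM0, hM⟩ := exists_bound₂ (W.c₁_cont l)
  obtain ⟨N, hN0, hN⟩ := exists_bound₂ (W.c₂_cont l)
  refine ⟨2 * (M + N), fun v => ?_⟩
  rw [mul_assoc]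
  refine mkPer_norm_le (hf := W.C₁_cont ω l v) (hg := W.C₂_cont ω l v)
    (pf := fun t x _ => W.C₁_per ω l v t x) (pg := fun t x _ => W.C₂_per ω l v t x)
    (fun t x hx => ?_) (fun t x hx => ?_)
  · rw [C₁, abs_mul, abs_neg]
    exact mul_le_mul ((hM x hx 0 (by simp)).trans (by linarith)) (sndC_le _ _ _)
      (abs_nonneg _) (by linarith)
  · rw [C₂, abs_mul]
    exact mul_le_mul ((hN x hx 1 (by simp)).trans (by linarith)) (fstC_le _ _ _)
      (abs_nonneg _) (by linarith)

lemma opD_bound (ω l : ℝ) : ∃ M, ∀ v, ‖W.opDₗ ω l v‖ ≤ M * ‖v‖ := by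
  have ha : ContinuousOn (fun p : ℝ × ℝ => W.a p.2 l) (Icc (0 : ℝ) 1 ×ˢ Icc (0 : ℝ) 1) :=
    (W.a_cont l).comp continuousOn_snd (fun p hp => hp.2)
  obtain ⟨M, hM0, hM⟩ := exists_bound₂ ((W.c₁_cont l).div ha (fun p hp => W.a_ne l _ hp.2))
  obtain ⟨N, hN0, hN⟩ := exists_bound₂ ((W.c₂_cont l).div ha (fun p hp => W.a_ne l _ hp.2))
  refine ⟨2 * (M + N), fun v => ?_⟩
  rw [mul_assoc]
  refine mkPer_norm_le (hf := W.D₁_cont ω l v) (hg := W.D₂_cont ω l v)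
    (pf := fun t x _ => W.D₁_per ω l v t x) (pg := fun t x _ => W.D₂_per ω l v t x)
    (fun t x hx => ?_) (fun t x hx => ?_)
  · rw [D₁, abs_neg]
    have h := intervalIntegral.norm_integral_le_of_norm_le_const (a := 0) (b := x)
      (C := (M + N) * ‖v‖)
      (f := fun ξ => W.c₁ x ξ l / W.a ξ l * fstC v (t + ω * W.A x ξ l) ξ) (fun ξ hξ => by
        rw [Real.norm_eq_abs, abs_mul]
        have hξ' := uIcc_subset_Icc (by simp) hx (uIoc_subset_uIcc hξ)
        exact mul_le_mul ((hM x hx ξ hξ').trans (by linarith)) (fstC_le _ _ _)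
          (abs_nonneg _) (by linarith))
    refine h.trans (mul_le_of_le_one_right (by positivity) ?_)
    rw [sub_zero, abs_of_nonneg hx.1]
    exact hx.2
  · rw [D₂]
    have h := intervalIntegral.norm_integral_le_of_norm_le_const (a := x) (b := 1)
      (C := (M + N) * ‖v‖)
      (f := fun ξ => W.c₂ x ξ l / W.a ξ l * sndC v (t - ω * W.A x ξ l) ξ) (fun ξ hξ => by
        rw [Real.norm_eq_abs, abs_mul]
        have hξ' := uIcc_subset_Icc hx (by simp) (uIoc_subset_uIcc hξ)
        exact mul_le_mul ((hN x hx ξ hξ').trans (by linarith)) (sndC_le _ _ _)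
          (abs_nonneg _) (by linarith))
    refine h.trans (mul_le_of_le_one_right (by positivity) ?_)
    rw [abs_of_nonneg (by linarith [hx.2])]
    linarith [hx.1]

/-- The bounded linear operator `C(ω,l)` on `C2pi`, with components `C₁`, `C₂`. -/
def opC (ω l : ℝ) : C2pi →L[ℝ] C2pi :=
  LinearMap.mkContinuousOfExistsBound (W.opCₗ ω l) (W.opC_bound ω l)

/-- The bounded linear operator `D(ω,l)` on `C2pi`, with components `D₁`, `D₂`. -/
def opD (ω l : ℝ) : C2pi →L[ℝ] C2pi :=
  (W.opDₗ ω l).mkContinuousOfExistsBound (W.opD_bound ω l)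

/-- The linearization `I - C(ω,l) - D(ω,l) ∘ ∂ᵥB(0,ω,τ,l)`, where `∂ᵥB(0,ω,τ,l)` is the Fréchet
derivative at `v = 0` of the nonlinear operator `opB ω τ l`. -/
def linearization (ω τ l : ℝ) : C2pi →L[ℝ] C2pi :=
  ContinuousLinearMap.id ℝ C2pi - W.opC ω l - (W.opD ω l).comp (fderiv ℝ (W.opB ω τ l) 0)

end WaveData

/-- The index `dim ker T - codim range T` of an operator `T`; meaningful if `T` is Fredholm. -/
def fredholmIndex {E F : Type*} [NormedAddCommGroup E] [NormedSpace ℝ E]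
    [NormedAddCommGroup F] [NormedSpace ℝ F] (T : E →L[ℝ] F) : ℤ :=
  (Module.finrank ℝ T.ker : ℤ) - (Module.finrank ℝ (F ⧸ T.range) : ℤ)

end WaveHopf

end

/-!
The operator `T = I - C - D ∂B` acts on time-periodic pairs of functions on `[0,1]`, that is, on
pairs of functions on the cylinder (`cylEquiv`). In these terms `C` carries boundary traces into
the strip along the characteristics, with a reflection at each end, and `D` integrates along them.
The derivative `∂B` (`hasFDerivAt_opB`, from a Taylor expansion of `b` uniform in `x`) consists of
the off-diagonal multiplications by `b₂` and `b₁` and of terms that involve the primitive `J`.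

In general none of these operators is compact, since transport along characteristics preserves
singularities. But integrating along characteristics a function that is Lipschitz in `x` smooths
in `t` as well: for `ω ≠ 0` the integration variable can be traded for time, so the images of
bounded sets are equicontinuous (`isCompactOperator_integrateX_shear`). The same holds if the
function is first transported along the other family of characteristics, as these are transversal
to the first. Hence, with `x` and `y` the upper and lower off-diagonal parts of `D ∂B` without the
integral terms, the products `x y`, `x C`, `y C` and the integral terms after `D` are all compact,
and `T = (1 - x) (1 - y) (1 - C)` up to a compact operator (`exists_isUnit_sub_compact`).

Here `x² = y² = 0`, so the first two factors are invertible. For the third, following a wave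
around once, from one end to the other and back, gives `C³ = -q R C`, where `R` is a translation
in time and `q = exp (-∫ b₅ / a)`. As `q ≠ 1`, the operator `1 + q R` is invertible by a Neumann
series, in `q R` or in its inverse, and then so is `1 - C` (`isUnit_one_sub_of_cube`). An
invertible minus a compact operator is Fredholm of index zero (`fredholm_of_sub_compact`). Finally
`∫ b₅ / a` is continuous in the parameter, so it does not vanish near `0` either, which gives `δ`.
-/

noncomputable section

open Set Filter Topology
open scoped LinearMap.FiniteRangeSetoid BoundedContinuousFunction

namespace WaveHopf

/-! ### Compact perturbations of isomorphisms -/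

section Fredholm

universe u

variable {E F : Type u} [NormedAddCommGroup E] [NormedSpace ℝ E]
  [NormedAddCommGroup F] [NormedSpace ℝ F]

/-- The Fredholm alternative: Mathlib has it for the resolvent of a compact endomorphism, here that
of `e⁻¹ K` at `1`. -/
lemma bijective_of_injective_sub_compact [CompleteSpace E] (e : E ≃L[ℝ] F) {K : E →L[ℝ] F}
    (hK : IsCompactOperator K)
    (hinj : Function.Injective ((e : E →L[ℝ] F) - K)) :
    Function.Bijective ((e : E →L[ℝ] F) - K) := by
  set G : E →L[ℝ] E := (e.symm : F →L[ℝ] E) ∘L K with hG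
  have hGc : IsCompactOperator G := hK.clm_comp (e.symm : F →L[ℝ] E)
  have hfac : ∀ x, ((e : E →L[ℝ] F) - K) x = e ((algebraMap ℝ (E →L[ℝ] E) 1 - G) x) := by
    intro x
    simp [hG]
  rcases IsCompactOperator.hasEigenvalue_or_mem_resolventSet hGc one_ne_zero with h | h
  · obtain ⟨x, hx⟩ := h.exists_hasEigenvector
    refine absurd (hinj (a₁ := x) (a₂ := 0) ?_) hx.2
    have h1 : G x = x := by simpa using hx.apply_eq_smul
    rw [hfac, map_zero]
    simp [h1]
  · rw [spectrum.mem_resolventSet_iff, ContinuousLinearMap.isUnit_iff_bijective] at h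
    have : (((e : E →L[ℝ] F) - K : E →L[ℝ] F) : E → F) =
        e ∘ (algebraMap ℝ (E →L[ℝ] E) 1 - G) := funext hfac
    rw [this]
    exact e.bijective.comp h

lemma finiteDimensional_ker_sub_compact (e : E ≃L[ℝ] F) {K : E →L[ℝ] F}
    (hK : IsCompactOperator K) :
    FiniteDimensional ℝ ((e : E →L[ℝ] F) - K).ker := by
  set G : E →L[ℝ] E := (e.symm : F →L[ℝ] E) ∘L K with hG
  have hGc : IsCompactOperator G := hK.clm_comp (e.symm : F →L[ℝ] E)
  set V := ((e : E →L[ℝ] F) - K).ker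
  have hfix : ∀ x ∈ V, G x = x := by
    intro x hx
    have h1 : e x - K x = 0 := by simpa [V] using hx
    simp [hG, ← sub_eq_zero.1 h1]
  have hV : ∀ x ∈ V, (G : E →ₗ[ℝ] E) x ∈ V := fun x hx => by
    have := hfix x hx
    simpa [this] using hx
  have hcl : IsClosed (V : Set E) := ((e : E →L[ℝ] F) - K).isClosed_ker
  have hc := IsCompactOperator.restrict (f := (G : E →ₗ[ℝ] E)) hGc hV hcl
  refine FiniteDimensional.of_isCompactOperator_id (𝕜 := ℝ) (E := V) ?_
  have hid : (id : V → V) = (G : E →ₗ[ℝ] E).restrict hV :=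
    funext fun x => Subtype.ext (hfix x x.2).symm
  rw [hid]
  exact hc

/-- The dual half of the Fredholm alternative, without adjoints: a surjective `e - K` has a bounded
right inverse `R`, because its kernel is finite-dimensional and hence complemented; `R` is an
injective compact perturbation of `e⁻¹`, so it is bijective. -/
lemma bijective_of_surjective_sub_compact [CompleteSpace E] [CompleteSpace F]
    (e : E ≃L[ℝ] F) {K : E →L[ℝ] F} (hK : IsCompactOperator K)
    (hsurj : Function.Surjective ((e : E →L[ℝ] F) - K)) :
    Function.Bijective ((e : E →L[ℝ] F) - K) := by
  have := finiteDimensional_ker_sub_compact e hK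
  set T := (e : E →L[ℝ] F) - K with hT
  obtain ⟨p, hp⟩ := Submodule.ClosedComplemented.of_finiteDimensional T.ker
  have hker : (T.prod p).ker = ⊥ := by
    rw [eq_bot_iff]
    intro x hx
    have h1 : T x = 0 ∧ p x = 0 := by simpa using hx
    have h2 := hp ⟨x, h1.1⟩
    simpa [h1.2] using congrArg Subtype.val h2.symm
  have hran : (T.prod p).range = ⊤ := by
    rw [eq_top_iff]
    rintro ⟨y, n⟩ -
    obtain ⟨x, rfl⟩ := hsurj y
    refine ⟨x - p x + n, ?_⟩
    have hn : ∀ m : T.ker, T m = 0 := fun m => m.2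
    simp [hn, hp]
  let Ψ := ContinuousLinearEquiv.ofBijective (T.prod p) hker hran
  let R : F →L[ℝ] E := (Ψ.symm : F × T.ker →L[ℝ] E) ∘L ContinuousLinearMap.inl ℝ F T.ker
  have hR : ∀ y, T (R y) = y := fun y =>
    congrArg Prod.fst (Ψ.apply_symm_apply (y, (0 : T.ker)))
  -- `R` is again a compact perturbation of an isomorphism: `R = e⁻¹ + e⁻¹ K R`
  have hRe : R = (e.symm : F →L[ℝ] E) - (-((e.symm : F →L[ℝ] E) ∘L K ∘L R)) := by
    ext y
    have h1 : e (R y) - K (R y) = y := hR y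
    apply e.injective
    simp [← sub_eq_iff_eq_add, h1]
  have hRc : IsCompactOperator (-((e.symm : F →L[ℝ] E) ∘L K ∘L R)) :=
    ((hK.comp_clm R).clm_comp (e.symm : F →L[ℝ] E)).neg
  have hRb : Function.Bijective R := by
    have h1 : Function.Injective R := Function.LeftInverse.injective hR
    rw [hRe] at h1 ⊢
    exact bijective_of_injective_sub_compact e.symm hRc h1
  refine ⟨fun x y hxy => ?_, hsurj⟩
  obtain ⟨u, rfl⟩ := hRb.2 x
  obtain ⟨w, rfl⟩ := hRb.2 y
  rw [hR, hR] at hxy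
  rw [hxy]

/-- A compact perturbation `T = e - K` of an isomorphism is Fredholm of index zero. A linear map `φ`
from the kernel of `T` to an algebraic complement `Z` of its range gives a finite rank perturbation
of `T`, which is again `e` minus a compact operator. For `φ` of maximal rank it is injective or
surjective, hence bijective, and then so is `φ`. -/
theorem fredholm_of_sub_compact [CompleteSpace E] [CompleteSpace F]
    (e : E ≃L[ℝ] F) {K : E →L[ℝ] F} (hK : IsCompactOperator K) :
    ((e : E →L[ℝ] F) - K).IsFredholm ∧ fredholmIndex ((e : E →L[ℝ] F) - K) = 0 := by
  have := finiteDimensional_ker_sub_compact e hK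
  set T := (e : E →L[ℝ] F) - K with hT
  obtain ⟨p, hp⟩ := Submodule.ClosedComplemented.of_finiteDimensional T.ker
  obtain ⟨Z, hZ⟩ := Submodule.exists_isCompl T.range
  let pert (φ : T.ker →ₗ[ℝ] Z) : E →L[ℝ] F :=
    Z.subtypeL ∘L (LinearMap.toContinuousLinearMap φ) ∘L p
  have pert_apply : ∀ φ x, pert φ x = (φ (p x) : F) := fun φ x => rfl
  have pert_compact : ∀ φ, IsCompactOperator (K - pert φ) := fun φ => by
    refine hK.sub ?_
    exact (isCompactOperator_of_locallyCompactSpace_rng (Z.subtypeL ∘L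
      (LinearMap.toContinuousLinearMap φ))).comp_clm p
  have hTe : ∀ φ, (e : E →L[ℝ] F) - (K - pert φ) = T + pert φ := fun φ => by
    rw [hT]; abel
  have split : ∀ φ x, (T + pert φ) x = 0 → T x = 0 ∧ φ (p x) = 0 := by
    intro φ x hx
    have h1 : T x + (φ (p x) : F) = 0 := hx
    have h2 : T x ∈ T.range ⊓ Z := ⟨⟨x, rfl⟩, by
      rw [eq_neg_of_add_eq_zero_left h1]
      exact Z.neg_mem (φ (p x)).2⟩
    rw [hZ.inf_eq_bot, Submodule.mem_bot] at h2
    refine ⟨h2, ?_⟩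
    rw [h2, zero_add] at h1
    exact Subtype.ext h1
  have inj_of : ∀ φ : T.ker →ₗ[ℝ] Z, Function.Injective φ → Function.Injective (T + pert φ) := by
    intro φ hφ
    rw [injective_iff_map_eq_zero]
    intro x hx
    obtain ⟨h1, h2⟩ := split φ x hx
    have h3 : p x = 0 := hφ (by rw [h2, map_zero])
    have h4 := hp ⟨x, h1⟩
    simpa [h3] using congrArg Subtype.val h4.symm
  have surj_of : ∀ φ : T.ker →ₗ[ℝ] Z, Function.Surjective φ → Function.Surjective (T + pert φ) := by
    intro φ hφ y
    have hy : y ∈ T.range ⊔ Z := by rw [hZ.sup_eq_top]; trivial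
    obtain ⟨_, ⟨x, rfl⟩, z, hz, rfl⟩ := Submodule.mem_sup.1 hy
    obtain ⟨n, hn⟩ := hφ ⟨z, hz⟩
    refine ⟨x - p x + n, ?_⟩
    have hk : ∀ m : T.ker, T m = 0 := fun m => m.2
    simp [hk, hp, pert_apply, hn]
  -- `Z` is not yet known to be finite-dimensional, so the dimensions are compared as cardinals
  obtain ⟨φ, hφ⟩ : ∃ φ : T.ker →ₗ[ℝ] Z, Function.Bijective (T + pert φ) := by
    rcases le_total (Module.rank ℝ T.ker) (Module.rank ℝ Z) with h | h
    · obtain ⟨φ, hφ⟩ := rank_le_iff_exists_linearMap.1 h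
      refine ⟨φ, ?_⟩
      have := inj_of φ hφ
      rw [← hTe] at this ⊢
      exact bijective_of_injective_sub_compact e (pert_compact φ) this
    · obtain ⟨j, hj⟩ := rank_le_iff_exists_linearMap.1 h
      obtain ⟨φ, hφ⟩ := j.exists_leftInverse_of_injective (LinearMap.ker_eq_bot.2 hj)
      refine ⟨φ, ?_⟩
      have := surj_of φ (fun z => ⟨j z, LinearMap.congr_fun hφ z⟩)
      rw [← hTe] at this ⊢
      exact bijective_of_surjective_sub_compact e (pert_compact φ) this
  have φinj : Function.Injective φ := by
    rw [injective_iff_map_eq_zero]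
    intro n hn
    have h1 : (T + pert φ) (n : E) = 0 := by
      have hk : T n = 0 := n.2
      simp [hk, pert_apply, hp, hn]
    have h2 := hφ.1 (a₁ := (n : E)) (a₂ := 0) (by rw [h1, map_zero])
    exact Subtype.ext h2
  have φsurj : Function.Surjective φ := by
    intro z
    obtain ⟨x, hx⟩ := hφ.2 (z : F)
    have h1 : T x + (φ (p x) : F) = z := hx
    have h2 : T x ∈ T.range ⊓ Z := ⟨⟨x, rfl⟩, by
      rw [eq_sub_of_add_eq h1]
      exact Z.sub_mem z.2 (φ (p x)).2⟩
    rw [hZ.inf_eq_bot, Submodule.mem_bot] at h2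
    rw [h2, zero_add] at h1
    exact ⟨p x, Subtype.ext h1⟩
  constructor
  · let Ψ := ContinuousLinearEquiv.ofBijective (T + pert φ) (LinearMap.ker_eq_bot.2 hφ.1)
      (LinearMap.range_eq_top.2 hφ.2)
    have hq := Ψ.toLinearEquiv.isQuasiInverse
    refine ContinuousLinearMap.IsFredholm.of_isQuasiInverse
      (v := (Ψ.symm : F →L[ℝ] E)) (hq.congr (Setoid.refl _) ?_)
    rw [LinearMap.FiniteRangeSetoid.equiv_iff_hasNoetherianRange]
    have hdiff : (T : E →ₗ[ℝ] F) - Ψ.toLinearEquiv =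
        (-(Z.subtype ∘ₗ φ)) ∘ₗ (p : E →ₗ[ℝ] T.ker) := by
      ext x
      change T x - (T x + (φ (p x) : F)) = -(φ (p x) : F)
      abel
    rw [hdiff]
    exact (LinearMap.HasNoetherianRange.of_isNoetherian_dom).comp_right _
  · have h1 := (LinearEquiv.ofBijective φ ⟨φinj, φsurj⟩).finrank_eq
    have h2 := (Submodule.quotientEquivOfIsCompl T.range Z hZ).finrank_eq
    rw [fredholmIndex, h1, h2, sub_self]

end Fredholm

/-! ### Transport, traces and integration on the cylinder -/

instance : Fact (0 < 2 * Real.pi) := ⟨Real.two_pi_pos⟩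

/-- The circle `ℝ / 2πℤ` of times. -/
abbrev Circ : Type := AddCircle (2 * Real.pi)

/-- The space interval `[0,1]`. -/
abbrev UnitI : Type := Icc (0 : ℝ) 1

/-- Continuous real functions on the cylinder, the scalar version of the space `C2pi`. Working on
the compact cylinder makes periodicity automatic and the Arzelà–Ascoli theorem available. -/
abbrev CylFun : Type := C(Circ × UnitI, ℝ)

/-- The retraction of `ℝ` onto `[0,1]`; it lets elements of `UnitI` occur under integrals over real
intervals. -/
abbrev clamp (x : ℝ) : UnitI := projIcc (0 : ℝ) 1 zero_le_one x

lemma continuous_clamp : Continuous clamp := continuous_projIcc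

lemma clamp_coe (x : UnitI) : clamp x = x := projIcc_val _ _

lemma clamp_lipschitz (x y : ℝ) : |(clamp x : ℝ) - clamp y| ≤ |x - y| :=
  abs_projIcc_sub_projIcc zero_le_one

lemma abs_apply_le (f : CylFun) (p : Circ × UnitI) : |f p| ≤ ‖f‖ := f.norm_coe_le_norm p

/-- Composition with a continuous self-map of the cylinder. -/
def pull (g : C(Circ × UnitI, Circ × UnitI)) : CylFun →L[ℝ] CylFun :=
  LinearMap.mkContinuous
    { toFun := fun f => f.comp g
      map_add' := fun _ _ => rfl
      map_smul' := fun _ _ => rfl } 1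
    (fun f => by
      rw [one_mul, ContinuousMap.norm_le _ (norm_nonneg _)]
      exact fun p => f.norm_coe_le_norm (g p))

lemma norm_pull_le (g : C(Circ × UnitI, Circ × UnitI)) : ‖pull g‖ ≤ 1 :=
  LinearMap.mkContinuous_norm_le _ zero_le_one _

/-- Translation in time by an amount `φ x` that depends on `x`. -/
def shear (φ : C(UnitI, ℝ)) : CylFun →L[ℝ] CylFun :=
  pull ⟨fun p => (p.1 + ((φ p.2 : ℝ) : Circ), p.2), by
    have : Continuous fun y : ℝ => (y : Circ) := AddCircle.continuous_mk'  _
    fun_prop⟩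

@[simp] lemma shear_apply (φ : C(UnitI, ℝ)) (f : CylFun) (t : Circ) (x : UnitI) :
    shear φ f (t, x) = f (t + ((φ x : ℝ) : Circ), x) := rfl

/-- The trace at `x₀`, extended to a function that is constant in `x`. -/
def traceAt (x₀ : UnitI) : CylFun →L[ℝ] CylFun :=
  pull ⟨fun p => (p.1, x₀), by fun_prop⟩

@[simp] lemma traceAt_apply (x₀ : UnitI) (f : CylFun) (t : Circ) (x : UnitI) :
    traceAt x₀ f (t, x) = f (t, x₀) := rfl

/-- Multiplication by a function of `x`. -/
def mulX (m : C(UnitI, ℝ)) : CylFun →L[ℝ] CylFun :=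
  ContinuousLinearMap.mul ℝ CylFun (m.comp ContinuousMap.snd)

@[simp] lemma mulX_apply (m : C(UnitI, ℝ)) (f : CylFun) (t : Circ) (x : UnitI) :
    mulX m f (t, x) = m x * f (t, x) := rfl

lemma continuous_slice (f : CylFun) (t : Circ) : Continuous fun ξ : ℝ => f (t, clamp ξ) :=
  f.continuous.comp (continuous_const.prodMk continuous_clamp)

/-- Integration in `x` from the left end, at a fixed time. -/
def integrateX : CylFun →L[ℝ] CylFun :=
  LinearMap.mkContinuous
    { toFun := fun f => ⟨fun p => ∫ ξ in (0 : ℝ)..p.2, f (p.1, clamp ξ), by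
        refine intervalIntegral.continuous_parametric_intervalIntegral_of_continuous
          (f := fun (p : Circ × UnitI) ξ => f (p.1, clamp ξ)) ?_ (by fun_prop)
        exact f.continuous.comp (((continuous_fst.comp continuous_fst)).prodMk
          (continuous_clamp.comp continuous_snd))⟩
      map_add' := fun f g => by
        ext p
        exact intervalIntegral.integral_add ((continuous_slice f p.1).intervalIntegrable _ _)
          ((continuous_slice g p.1).intervalIntegrable _ _)
      map_smul' := fun r f => by
        ext p
        exact intervalIntegral.integral_const_mul _ _ } 1
    (fun f => by
      rw [one_mul, ContinuousMap.norm_le _ (norm_nonneg _)]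
      rintro ⟨t, x⟩
      have h := intervalIntegral.norm_integral_le_of_norm_le_const (a := 0) (b := (x : ℝ))
        (C := ‖f‖) (f := fun ξ => f (t, clamp ξ)) (fun ξ _ => f.norm_coe_le_norm _)
      refine h.trans (mul_le_of_le_one_right (norm_nonneg _) ?_)
      rw [sub_zero, abs_of_nonneg x.2.1]
      exact x.2.2)

lemma integrateX_apply (f : CylFun) (t : Circ) (x : UnitI) :
    integrateX f (t, x) = ∫ ξ in (0 : ℝ)..x, f (t, clamp ξ) := rfl

/-- `H f` is Lipschitz in `x` with a constant controlled by the sup norm of `f`. -/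
def LipschitzInX (H : CylFun →L[ℝ] CylFun) : Prop :=
  ∃ L : ℝ, 0 ≤ L ∧ ∀ (f : CylFun) (t : Circ) (x y : UnitI),
    |H f (t, x) - H f (t, y)| ≤ L * ‖f‖ * |(x : ℝ) - y|

lemma lipschitzInX_integrateX : LipschitzInX integrateX := by
  refine ⟨1, zero_le_one, fun f t x y => ?_⟩
  rw [integrateX_apply, integrateX_apply, intervalIntegral.integral_interval_sub_left
    ((continuous_slice f t).intervalIntegrable _ _) ((continuous_slice f t).intervalIntegrable _ _),
    one_mul]
  exact intervalIntegral.norm_integral_le_of_norm_le_const fun ξ _ => f.norm_coe_le_norm _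

lemma lipschitzInX_traceAt (x₀ : UnitI) : LipschitzInX (traceAt x₀) :=
  ⟨0, le_rfl, fun f t x y => by simp⟩

lemma LipschitzInX.comp {H : CylFun →L[ℝ] CylFun} (hH : LipschitzInX H)
    (G : CylFun →L[ℝ] CylFun) : LipschitzInX (H ∘L G) := by
  obtain ⟨L, hL, h⟩ := hH
  refine ⟨L * ‖G‖, by positivity, fun f t x y => (h (G f) t x y).trans ?_⟩
  rw [mul_assoc L ‖G‖]
  exact mul_le_mul_of_nonneg_right (mul_le_mul_of_nonneg_left (G.le_opNorm f) hL) (abs_nonneg _)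

lemma LipschitzInX.sub {H G : CylFun →L[ℝ] CylFun} (hH : LipschitzInX H) (hG : LipschitzInX G) :
    LipschitzInX (H - G) := by
  obtain ⟨L, hL, h⟩ := hH
  obtain ⟨L', hL', h'⟩ := hG
  refine ⟨L + L', by positivity, fun f t x y => ?_⟩
  have e : (H - G) f (t, x) - (H - G) f (t, y) =
      (H f (t, x) - H f (t, y)) - (G f (t, x) - G f (t, y)) := by
    simp only [sub_apply, ContinuousMap.sub_apply]
    ring
  rw [e]
  refine (abs_sub _ _).trans ((add_le_add (h f t x y) (h' f t x y)).trans_eq ?_)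
  ring

/-- An operator on `CylFun` is compact as soon as the images of the unit ball are equicontinuous
in `t` and equi-Lipschitz in `x`. -/
lemma isCompactOperator_of_equicontinuous {G : CylFun →L[ℝ] CylFun} (hx : LipschitzInX G)
    (ht : ∀ ε > 0, ∃ d > 0, ∀ h : ℝ, |h| < d → ∀ f : CylFun, ‖f‖ ≤ 1 → ∀ t x,
      |G f (t + (h : Circ), x) - G f (t, x)| ≤ ε) : IsCompactOperator G := by
  have key := isCompactOperator_iff_isCompact_closure_image_closedBall
    (G : CylFun →ₗ[ℝ] CylFun) zero_lt_one
  refine key.2 ?_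
  let e := ContinuousMap.isometryEquivBoundedOfCompact (Circ × UnitI) ℝ
  have hc : IsCompact (closure (e '' (G '' Metric.closedBall 0 1))) := by
    refine BoundedContinuousFunction.arzela_ascoli (Icc (-‖G‖) ‖G‖) isCompact_Icc _ ?_ ?_
    · rintro _ p ⟨_, ⟨f, hf, rfl⟩, rfl⟩
      refine abs_le.1 ((abs_apply_le (G f) p).trans ((G.le_opNorm f).trans ?_))
      exact mul_le_of_le_one_right (norm_nonneg _) (by simpa using hf)
    · rintro ⟨t, x⟩
      rw [Metric.equicontinuousAt_iff_right]
      intro ε hε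
      obtain ⟨L, hL, hLip⟩ := hx
      obtain ⟨d, hd, ht⟩ := ht (ε / 3) (by positivity)
      have h1 : ∀ᶠ s : Circ in 𝓝 t, ∃ h : ℝ, |h| < d ∧ s = t + (h : Circ) := by
        obtain ⟨t₀, rfl⟩ := QuotientAddGroup.mk_surjective t
        have := QuotientAddGroup.isOpenMap_coe (N := AddSubgroup.zmultiples (2 * Real.pi))
          |>.image_mem_nhds (Metric.ball_mem_nhds t₀ hd)
        filter_upwards [this]
        rintro _ ⟨s₀, hs₀, rfl⟩
        refine ⟨s₀ - t₀, by simpa [Real.dist_eq] using hs₀, ?_⟩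
        change (s₀ : Circ) = (t₀ : Circ) + ((s₀ - t₀ : ℝ) : Circ)
        rw [← AddCircle.coe_add]
        congr 1
        ring
      have h2 : ∀ᶠ y : UnitI in 𝓝 x, L * |(y : ℝ) - x| < ε / 3 := by
        have hcont : ContinuousAt (fun y : UnitI => L * |(y : ℝ) - x|) x := by fun_prop
        refine hcont.eventually_lt_const ?_
        simpa using by positivity
      rw [nhds_prod_eq]
      filter_upwards [h1.prod_mk h2]
      rintro ⟨s, y⟩ ⟨⟨h, hh, hs⟩, hy⟩ ⟨_, ⟨_, ⟨f, hf, rfl⟩, rfl⟩⟩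
      have hf1 : ‖f‖ ≤ 1 := by simpa using hf
      change |G f (t, x) - G f (s, y)| < ε
      simp only at hs hy
      have e1 := ht h hh f hf1 t x
      rw [← hs] at e1
      have e2 := hLip f s y x
      have e3 : L * ‖f‖ * |(y : ℝ) - x| ≤ L * |(y : ℝ) - x| := by
        have : L * ‖f‖ ≤ L := mul_le_of_le_one_right hL hf1
        gcongr
      have e4 : G f (t, x) - G f (s, y) =
        -(G f (s, x) - G f (t, x)) - (G f (s, y) - G f (s, x)) := by ring
      rw [e4]
      refine lt_of_le_of_lt (abs_sub _ _) ?_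
      rw [abs_neg]
      linarith
  have h3 : closure ((G : CylFun →ₗ[ℝ] CylFun) '' Metric.closedBall 0 1) =
      e.symm '' closure (e '' (G '' Metric.closedBall 0 1)) := by
    have h4 := e.symm.toHomeomorph.image_closure (e '' (G '' Metric.closedBall 0 1))
    refine Eq.trans ?_ h4.symm
    congr 1
    exact (e.toEquiv.symm_image_image _).symm
  rw [h3]
  exact hc.image e.symm.continuous

/-! ### Integration along characteristics is smoothing -/

/-- The primitive of `r` that vanishes at `0`. -/
def primitive (r : C(UnitI, ℝ)) : C(UnitI, ℝ) where
  toFun x := ∫ ξ in (0 : ℝ)..x, r (clamp ξ)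
  continuous_toFun := by
    have h : Continuous fun x : ℝ => ∫ ξ in (0 : ℝ)..x, r (clamp ξ) :=
      intervalIntegral.continuous_primitive
        (fun a b => (r.continuous.comp continuous_clamp).intervalIntegrable a b) 0
    exact h.comp continuous_subtype_val

lemma primitive_apply (r : C(UnitI, ℝ)) (x : UnitI) :
    primitive r x = ∫ ξ in (0 : ℝ)..x, r (clamp ξ) := rfl

/-- The primitive of a positive function has a globally Lipschitz inverse. -/
lemma exists_inverse_primitive (r : C(UnitI, ℝ)) (hr : ∀ x, 0 < r x) :
    ∃ (β : ℝ → ℝ) (L : ℝ), 0 ≤ L ∧ (∀ s s', |β s - β s'| ≤ L * |s - s'|) ∧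
      ∀ x, β (∫ ξ in (0 : ℝ)..x, r (clamp ξ)) = x := by
  obtain ⟨x₀, -, hx₀⟩ := isCompact_univ.exists_isMinOn (univ_nonempty (α := UnitI))
    r.continuous.continuousOn
  set r₀ := r x₀ with hr₀
  have hmin : ∀ x, r₀ ≤ r x := fun x => hx₀ (mem_univ x)
  have hpos : 0 < r₀ := hr x₀
  have hcont : Continuous fun ξ => r (clamp ξ) := r.continuous.comp continuous_clamp
  set α : ℝ → ℝ := fun x => ∫ ξ in (0 : ℝ)..x, r (clamp ξ) with hα
  have hsub : ∀ x y, α y - α x = ∫ ξ in x..y, r (clamp ξ) := fun x y =>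
    intervalIntegral.integral_interval_sub_left (hcont.intervalIntegrable _ _)
      (hcont.intervalIntegrable _ _)
  have hgrow : ∀ x y, x ≤ y → r₀ * (y - x) ≤ α y - α x := by
    intro x y hxy
    rw [hsub]
    have h := intervalIntegral.integral_mono_on (μ := MeasureTheory.volume) hxy
      (intervalIntegrable_const (c := r₀)) (hcont.intervalIntegrable x y) (fun ξ _ => hmin _)
    rw [intervalIntegral.integral_const, smul_eq_mul] at h
    linarith
  have hα0 : α 0 = 0 := by simp [hα]
  have hmono : StrictMono α := fun x y hxy => by
    have := hgrow x y hxy.le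
    have : 0 < r₀ * (y - x) := mul_pos hpos (sub_pos.2 hxy)
    linarith
  have hαc : Continuous α := intervalIntegral.continuous_primitive
    (fun a b => hcont.intervalIntegrable a b) 0
  have htop : Tendsto α atTop atTop := by
    refine tendsto_atTop_mono' _ ?_ (tendsto_id.const_mul_atTop hpos)
    filter_upwards [eventually_ge_atTop 0] with x hx
    have := hgrow 0 x hx
    simp only [id]
    linarith
  have hbot : Tendsto α atBot atBot := by
    refine tendsto_atBot_mono' _ ?_ (tendsto_id.const_mul_atBot hpos)
    filter_upwards [eventually_le_atBot 0] with x hx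
    have := hgrow x 0 hx
    simp only [id]
    linarith
  have hsurj : Function.Surjective α := hαc.surjective htop hbot
  let e := Equiv.ofBijective α ⟨hmono.injective, hsurj⟩
  refine ⟨e.symm, r₀⁻¹, by positivity, fun s s' => ?_, fun x => e.symm_apply_apply x⟩
  obtain ⟨x, rfl⟩ := e.surjective s
  obtain ⟨y, rfl⟩ := e.surjective s'
  rw [e.symm_apply_apply, e.symm_apply_apply, inv_mul_eq_div, le_div_iff₀ hpos, mul_comm]
  change r₀ * |x - y| ≤ |α x - α y|
  rcases le_total x y with h | h
  · have := hgrow x y h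
    rw [abs_sub_comm, abs_of_nonneg (sub_nonneg.2 h), abs_sub_comm]
    exact this.trans (le_abs_self _)
  · have := hgrow y x h
    rw [abs_of_nonneg (sub_nonneg.2 h)]
    exact this.trans (le_abs_self _)

/-- Substituting `s = α(ξ)`, where `α` is the primitive of `r > 0`. -/
lemma integrateX_mulX_shear_eq (r m : C(UnitI, ℝ)) (hr : ∀ x, 0 < r x) (κ : ℝ)
    {β : ℝ → ℝ} (hβc : Continuous β) (hβ : ∀ x, β (∫ ξ in (0 : ℝ)..x, r (clamp ξ)) = x)
    (g : CylFun) (t : Circ) (x : UnitI) :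
    integrateX (mulX m (shear (κ • primitive r) g)) (t, x) =
      ∫ s in (0 : ℝ)..primitive r x, m (clamp (β s)) / r (clamp (β s)) *
        g (t + ((κ * s : ℝ) : Circ), clamp (β s)) := by
  have hcont : Continuous fun ξ => r (clamp ξ) := r.continuous.comp continuous_clamp
  set α : ℝ → ℝ := fun x => ∫ ξ in (0 : ℝ)..x, r (clamp ξ) with hα
  have hmk : Continuous fun y : ℝ => (y : Circ) := AddCircle.continuous_mk' _
  have hcl := continuous_clamp
  have hGc : Continuous fun s : ℝ => m (clamp (β s)) / r (clamp (β s)) *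
        g (t + ((κ * s : ℝ) : Circ), clamp (β s)) := by
    refine Continuous.mul (Continuous.div (by fun_prop) (by fun_prop) fun s => (hr _).ne') ?_
    fun_prop
  have h := intervalIntegral.integral_comp_mul_deriv (a := 0) (b := (x : ℝ)) (f := α)
    (f' := fun ξ => r (clamp ξ))
    (fun ξ _ => intervalIntegral.integral_hasDerivAt_right (hcont.intervalIntegrable _ _)
      (hcont.stronglyMeasurableAtFilter _ _) hcont.continuousAt) hcont.continuousOn hGc
  have hα0 : α 0 = 0 := by simp [hα]
  rw [hα0] at h
  rw [integrateX_apply, primitive_apply]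
  refine Eq.trans ?_ h
  refine intervalIntegral.integral_congr fun ξ hξ => ?_
  have hξ' : ξ ∈ Icc (0 : ℝ) 1 := uIcc_subset_Icc (by simp) x.2 hξ
  have hpr : primitive r (clamp ξ) = α ξ := by
    rw [primitive_apply]
    simp only [clamp, projIcc_of_mem zero_le_one hξ', hα]
  simp only [mulX_apply, shear_apply, Function.comp, hβ, ContinuousMap.smul_apply, hpr, hα,
    smul_eq_mul]
  have := (hr (clamp ξ)).ne'
  field_simp

/-- The smoothing property behind all compactness statements. For `α` the primitive of `r`,
integrating `H f` along the curves `ξ ↦ (t + κ α(ξ), ξ)` with `κ ≠ 0` is a compact operation when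
`H f` is Lipschitz in `x`: after the substitution `s = α(ξ)` the time enters as `t + κ s`, so a
translation by `h` in `t` can be moved to a translation by `h / κ` of the integration variable,
under which only functions with a known modulus of continuity in `x` and the end points change. -/
theorem isCompactOperator_integrateX_shear (r m : C(UnitI, ℝ)) (hr : ∀ x, 0 < r x) {κ : ℝ}
    (hκ : κ ≠ 0) {H : CylFun →L[ℝ] CylFun} (hH : LipschitzInX H) :
    IsCompactOperator (integrateX ∘L mulX m ∘L shear (κ • primitive r) ∘L H) := by
  refine isCompactOperator_of_equicontinuous (lipschitzInX_integrateX.comp _) fun ε hε => ?_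
  obtain ⟨β, Lβ, hLβ, hβL, hβ⟩ := exists_inverse_primitive r hr
  obtain ⟨L, hL, hHL⟩ := hH
  have hβc : Continuous β := (LipschitzWith.of_dist_le_mul (K := ⟨Lβ, hLβ⟩) hβL).continuous
  have hcl := continuous_clamp
  -- the density after the substitution, a uniformly continuous function
  let q : C(UnitI, ℝ) := ⟨fun x => m x / r x,
    m.continuous.div r.continuous fun x => (hr x).ne'⟩
  set n : ℝ → ℝ := fun s => q (clamp (β s)) with hn
  have hnc : Continuous n := by fun_prop
  have hnN : ∀ s, |n s| ≤ ‖q‖ := fun s => q.norm_coe_le_norm _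
  set X := ‖primitive r‖ with hX
  set C := ‖H‖ with hC
  have hclβ : ∀ s δ, |(clamp (β (s + δ)) : ℝ) - clamp (β s)| ≤ Lβ * |δ| := fun s δ => by
    refine (clamp_lipschitz _ _).trans ((hβL _ _).trans_eq ?_)
    rw [add_sub_cancel_left]
  -- a modulus of continuity for the density; the `+ 1` keeps the denominators positive
  obtain ⟨ρ, hρ, hunif⟩ : ∃ ρ > 0, ∀ s δ : ℝ, |δ| < ρ →
      |n s - n (s + δ)| ≤ ε / 2 / (X * C + 1) := by
    have hq := CompactSpace.uniformContinuous_of_continuous q.continuous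
    rw [Metric.uniformContinuous_iff] at hq
    obtain ⟨ρ, hρ, hq⟩ := hq (ε / 2 / (X * C + 1)) (by positivity)
    refine ⟨ρ / (Lβ + 1), by positivity, fun s δ hδ => ?_⟩
    rw [lt_div_iff₀ (by positivity)] at hδ
    refine (hq ?_).le
    rw [dist_comm, Subtype.dist_eq, Real.dist_eq]
    refine (hclβ s δ).trans_lt ?_
    nlinarith [abs_nonneg δ]
  set D := 2 * ‖q‖ * C + X * ‖q‖ * L * Lβ with hD
  have hD0 : 0 ≤ D := by positivity
  set σ := min ρ (ε / 2 / (D + 1)) with hσ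
  have hσ0 : 0 < σ := lt_min hρ (by positivity)
  refine ⟨σ * |κ|, by positivity, fun h hh f hf t x => ?_⟩
  set δ := h / κ with hδ
  have hδσ : |δ| < σ := by
    rwa [hδ, abs_div, div_lt_iff₀ (abs_pos.2 hκ)]
  have hκδ : ∀ s, κ * (s + δ) = κ * s + h := fun s => by rw [hδ]; field_simp
  set g := H f with hg
  have hgC : ∀ p, |g p| ≤ C := fun p => (abs_apply_le g p).trans ((H.le_opNorm f).trans
    (mul_le_of_le_one_right (norm_nonneg _) hf))
  have hmk : Continuous fun y : ℝ => (y : Circ) := AddCircle.continuous_mk' _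
  set G : ℝ → ℝ := fun s => n s * g (t + ((κ * s : ℝ) : Circ), clamp (β s)) with hG
  set G' : ℝ → ℝ := fun s => n s * g (t + (h : Circ) + ((κ * s : ℝ) : Circ), clamp (β s)) with hG'
  have hGc : Continuous G := by fun_prop
  have hGc' : Continuous G' := by fun_prop
  have hGb : ∀ s, |G s| ≤ ‖q‖ * C := fun s => by
    rw [hG, abs_mul]
    exact mul_le_mul (hnN s) (hgC _) (abs_nonneg _) (norm_nonneg _)
  have e1 : (integrateX ∘L mulX m ∘L shear (κ • primitive r) ∘L H) f (t, x) =
      ∫ s in (0 : ℝ)..primitive r x, G s :=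
    integrateX_mulX_shear_eq r m hr κ hβc hβ g t x
  have e2 : (integrateX ∘L mulX m ∘L shear (κ • primitive r) ∘L H) f (t + (h : Circ), x) =
      ∫ s in (0 : ℝ)..primitive r x, G' s :=
    integrateX_mulX_shear_eq r m hr κ hβc hβ g (t + (h : Circ)) x
  rw [e1, e2]
  set y := primitive r x with hy
  have hyX : |y| ≤ X := (primitive r).norm_coe_le_norm x
  have hint : ∀ a b, IntervalIntegrable G MeasureTheory.volume a b :=
    fun a b => hGc.intervalIntegrable a b
  -- `G' s` and `G (s + δ)` evaluate `g` at the same time and at nearby positions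
  have e3 : (∫ s in (0 : ℝ)..y, G' s) - ∫ s in (0 : ℝ)..y, G s =
      (∫ s in (0 : ℝ)..y, (G' s - G (s + δ))) +
        ((∫ s in y..y + δ, G s) - ∫ s in (0 : ℝ)..δ, G s) := by
    have hGδ : Continuous fun s => G (s + δ) := by fun_prop
    rw [intervalIntegral.integral_sub (hGc'.intervalIntegrable _ _)
      (hGδ.intervalIntegrable _ _),
      intervalIntegral.integral_comp_add_right (f := G), zero_add]
    have a1 := intervalIntegral.integral_add_adjacent_intervals (hint 0 δ) (hint δ (y + δ))
    have a2 := intervalIntegral.integral_add_adjacent_intervals (hint 0 y) (hint y (y + δ))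
    linarith
  have b1 : |∫ s in y..y + δ, G s| ≤ ‖q‖ * C * |δ| := by
    have := intervalIntegral.norm_integral_le_of_norm_le_const (a := y) (b := y + δ) (f := G)
      (C := ‖q‖ * C) (fun s _ => hGb s)
    simpa using this
  have b2 : |∫ s in (0 : ℝ)..δ, G s| ≤ ‖q‖ * C * |δ| := by
    have := intervalIntegral.norm_integral_le_of_norm_le_const (a := 0) (b := δ) (f := G)
      (C := ‖q‖ * C) (fun s _ => hGb s)
    simpa using this
  set η := ε / 2 / (X * C + 1) with hη
  have b3 : |∫ s in (0 : ℝ)..y, (G' s - G (s + δ))| ≤ (η * C + ‖q‖ * (L * (Lβ * |δ|))) * X := by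
    have := intervalIntegral.norm_integral_le_of_norm_le_const (a := 0) (b := y)
      (f := fun s => G' s - G (s + δ)) (C := η * C + ‖q‖ * (L * (Lβ * |δ|))) (fun s _ => ?_)
    · refine this.trans ?_
      rw [sub_zero]
      gcongr
    · have c1 : t + (h : Circ) + ((κ * s : ℝ) : Circ) = t + ((κ * (s + δ) : ℝ) : Circ) := by
        rw [hκδ, AddCircle.coe_add]
        abel
      have c2 : G' s - G (s + δ) = (n s - n (s + δ)) *
            g (t + ((κ * (s + δ) : ℝ) : Circ), clamp (β s)) +
          n (s + δ) * (g (t + ((κ * (s + δ) : ℝ) : Circ), clamp (β s)) -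
            g (t + ((κ * (s + δ) : ℝ) : Circ), clamp (β (s + δ)))) := by
        simp only [hG, hG', c1]
        ring
      rw [c2]
      refine (abs_add_le _ _).trans (add_le_add ?_ ?_)
      · rw [abs_mul]
        exact mul_le_mul (hunif s δ (hδσ.trans_le (min_le_left _ _))) (hgC _) (abs_nonneg _)
          (by positivity)
      · rw [abs_mul]
        refine mul_le_mul (hnN _) ((hHL f _ _ _).trans ?_) (abs_nonneg _) (norm_nonneg _)
        rw [mul_assoc]
        refine mul_le_mul_of_nonneg_left ?_ hL
        refine (mul_le_of_le_one_left (abs_nonneg _) hf).trans ?_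
        rw [abs_sub_comm]
        exact hclβ s δ
  have f1 : η * (X * C) ≤ ε / 2 := by
    rw [hη, div_mul_eq_mul_div, div_le_iff₀ (by positivity)]
    nlinarith
  have f2 : D * |δ| ≤ ε / 2 := by
    have : |δ| ≤ ε / 2 / (D + 1) := (hδσ.trans_le (min_le_right _ _)).le
    rw [le_div_iff₀ (by positivity)] at this
    nlinarith [abs_nonneg δ]
  rw [e3]
  refine (abs_add_le _ _).trans ?_
  have := abs_sub (∫ s in y..y + δ, G s) (∫ s in (0 : ℝ)..δ, G s)
  calc _ ≤ (η * C + ‖q‖ * (L * (Lβ * |δ|))) * X + (‖q‖ * C * |δ| + ‖q‖ * C * |δ|) := by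
        linarith
    _ = η * (X * C) + D * |δ| := by rw [hD]; ring
    _ ≤ ε := by linarith

/-! ### Pairs of functions on the cylinder -/

/-- Pairs of functions on the cylinder. The norm is the maximum of the two norms, only equivalent to
the one of `C2pi`; compactness and the Fredholm property do not see the difference. -/
abbrev CylPair : Type := CylFun × CylFun

/-- Descent of a function continuous on `ℝ × [0,1]` and `2π`-periodic in `t` to the cylinder. -/
def descend (f : ℝ → ℝ → ℝ) (hf : Continuous fun p : ℝ × ℝ => f p.1 p.2)
    (hp : ∀ t x, f (t + 2 * Real.pi) x = f t x) : CylFun where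
  toFun p := Function.Periodic.lift (f := fun t => f t p.2) (c := 2 * Real.pi)
    (by intro t; exact hp t p.2) p.1
  continuous_toFun := by
    have hq : IsOpenQuotientMap (Prod.map (fun t : ℝ => (t : Circ)) (id : UnitI → UnitI)) :=
      (QuotientAddGroup.isOpenQuotientMap_mk).prodMap IsOpenQuotientMap.id
    refine hq.isQuotientMap.continuous_iff.2 ?_
    exact hf.comp (continuous_fst.prodMk (continuous_subtype_val.comp continuous_snd))

@[simp] lemma descend_apply {f : ℝ → ℝ → ℝ} {hf hp} (t : ℝ) (x : UnitI) :
    descend f hf hp ((t : Circ), x) = f t x := rfl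

lemma cylFun_ext {f g : CylFun} (h : ∀ (t : ℝ) (x : UnitI), f ((t : Circ), x) = g ((t : Circ), x)) :
    f = g := by
  ext ⟨t, x⟩
  obtain ⟨t₀, rfl⟩ := QuotientAddGroup.mk_surjective t
  exact h t₀ x

@[simp] lemma fstC_mkPer {f g : ℝ → ℝ → ℝ} {hf hg pf pg} (t : ℝ) (x : UnitI) :
    fstC (mkPer f g hf hg pf pg) t x = f t x := by
  change f t (clamp x) = f t x
  rw [clamp_coe]

@[simp] lemma sndC_mkPer {f g : ℝ → ℝ → ℝ} {hf hg pf pg} (t : ℝ) (x : UnitI) :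
    sndC (mkPer f g hf hg pf pg) t x = g t x := by
  change g t (clamp x) = g t x
  rw [clamp_coe]

lemma c2pi_ext {v w : C2pi} (h₁ : ∀ (t : ℝ) (x : UnitI), fstC v t x = fstC w t x)
    (h₂ : ∀ (t : ℝ) (x : UnitI), sndC v t x = sndC w t x) : v = w := by
  apply Subtype.ext
  ext1 ⟨t, x⟩
  have e₁ := h₁ t x
  have e₂ := h₂ t x
  rw [fstC, fstC, projIcc_val] at e₁
  rw [sndC, sndC, projIcc_val] at e₂
  exact (WithLp.ofLp_injective 1) (Prod.ext e₁ e₂)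

lemma continuous_unroll (f : CylFun) : Continuous fun p : ℝ × ℝ => f ((p.1 : Circ), clamp p.2) := by
  have hmk : Continuous fun y : ℝ => (y : Circ) := AddCircle.continuous_mk' _
  have hcl := continuous_clamp
  fun_prop

lemma coe_add_two_pi (t : ℝ) : ((t + 2 * Real.pi : ℝ) : Circ) = t := by
  rw [AddCircle.coe_add, AddCircle.coe_period, add_zero]

/-- The linear bijection underlying `cylEquiv`. -/
def cylEquivLinear : C2pi ≃ₗ[ℝ] CylPair where
  toFun v := (descend (fstC v) (fstC_continuous v) (fstC_per v),
    descend (sndC v) (sndC_continuous v) (sndC_per v))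
  invFun z := mkPer (fun t x => z.1 ((t : Circ), clamp x)) (fun t x => z.2 ((t : Circ), clamp x))
    (continuous_unroll z.1).continuousOn (continuous_unroll z.2).continuousOn
    (fun t x _ => by rw [coe_add_two_pi]) (fun t x _ => by rw [coe_add_two_pi])
  map_add' v w := Prod.ext (cylFun_ext fun t x => rfl) (cylFun_ext fun t x => rfl)
  map_smul' r v := Prod.ext (cylFun_ext fun t x => rfl) (cylFun_ext fun t x => rfl)
  left_inv v := c2pi_ext (fun t x => by simp) (fun t x => by simp)
  right_inv z := Prod.ext (cylFun_ext fun t x => by simp)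
    (cylFun_ext fun t x => by simp)

/-- Pairs of functions on the cylinder, identified with the elements of `C2pi`. -/
def cylEquiv : C2pi ≃L[ℝ] CylPair :=
  cylEquivLinear.toContinuousLinearEquivOfBounds 1 2
    (fun v => by
      rw [one_mul]
      refine max_le ?_ ?_
      · rw [ContinuousMap.norm_le _ (norm_nonneg _)]
        rintro ⟨t, x⟩
        obtain ⟨t, rfl⟩ := QuotientAddGroup.mk_surjective t
        exact fstC_le v t x
      · rw [ContinuousMap.norm_le _ (norm_nonneg _)]
        rintro ⟨t, x⟩
        obtain ⟨t, rfl⟩ := QuotientAddGroup.mk_surjective t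
        exact sndC_le v t x)
    (fun z => mkPer_norm_le
      (fun t x _ => (abs_apply_le z.1 _).trans (norm_fst_le z))
      (fun t x _ => (abs_apply_le z.2 _).trans (norm_snd_le z)))

@[simp] lemma cylEquiv_fst (v : C2pi) (t : ℝ) (x : UnitI) :
    (cylEquiv v).1 ((t : Circ), x) = fstC v t x := rfl

@[simp] lemma cylEquiv_snd (v : C2pi) (t : ℝ) (x : UnitI) :
    (cylEquiv v).2 ((t : Circ), x) = sndC v t x := rfl

instance : CompleteSpace C2pi :=
  (completeSpace_congr (e := cylEquiv.toEquiv) cylEquiv.isUniformEmbedding).2 inferInstance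

section Algebra

/-- The operator matrix with rows `(0, P)` and `(Q, 0)`. -/
def offDiag (P Q : CylFun →L[ℝ] CylFun) : CylPair →L[ℝ] CylPair :=
  (P ∘L ContinuousLinearMap.snd ℝ CylFun CylFun).prod (Q ∘L ContinuousLinearMap.fst ℝ CylFun CylFun)

@[simp] lemma offDiag_apply (P Q : CylFun →L[ℝ] CylFun) (z : CylPair) :
    offDiag P Q z = (P z.2, Q z.1) := rfl

lemma isCompactOperator_prodMap {P Q : CylFun →L[ℝ] CylFun} (hP : IsCompactOperator P)
    (hQ : IsCompactOperator Q) : IsCompactOperator (P.prodMap Q) := by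
  have e : P.prodMap Q =
      ContinuousLinearMap.inl ℝ CylFun CylFun ∘L P ∘L ContinuousLinearMap.fst ℝ CylFun CylFun +
      ContinuousLinearMap.inr ℝ CylFun CylFun ∘L Q ∘L ContinuousLinearMap.snd ℝ CylFun CylFun := by
    ext z <;> simp
  rw [e]
  exact ((hP.comp_clm (ContinuousLinearMap.fst ℝ CylFun CylFun)).clm_comp
    (ContinuousLinearMap.inl ℝ CylFun CylFun)).add
    ((hQ.comp_clm (ContinuousLinearMap.snd ℝ CylFun CylFun)).clm_comp
    (ContinuousLinearMap.inr ℝ CylFun CylFun))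

lemma isCompactOperator_prod {P Q : CylPair →L[ℝ] CylFun} (hP : IsCompactOperator P)
    (hQ : IsCompactOperator Q) : IsCompactOperator (P.prod Q) := by
  have e : P.prod Q = ContinuousLinearMap.inl ℝ CylFun CylFun ∘L P +
      ContinuousLinearMap.inr ℝ CylFun CylFun ∘L Q := by
    ext z <;> simp
  rw [e]
  exact (hP.clm_comp (ContinuousLinearMap.inl ℝ CylFun CylFun)).add
    (hQ.clm_comp (ContinuousLinearMap.inr ℝ CylFun CylFun))

lemma isUnit_one_sub_of_sq_eq_zero {R : Type*} [Ring R] {x : R} (h : x * x = 0) :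
    IsUnit (1 - x) :=
  IsNilpotent.isUnit_one_sub ⟨2, by rw [sq, h]⟩

/-- `1 + q R` is invertible for an invertible isometry `R` and `q > 0`, `q ≠ 1`. -/
lemma isUnit_one_add_smul {V : Type*} [NormedAddCommGroup V] [NormedSpace ℝ V] [CompleteSpace V]
    {R R' : V →L[ℝ] V} (hR : ‖R‖ ≤ 1) (hR' : ‖R'‖ ≤ 1) (h : R * R' = 1) (h' : R' * R = 1)
    {q : ℝ} (hq : 0 < q) (hq1 : q ≠ 1) : IsUnit (1 + q • R) := by
  rcases lt_or_gt_of_ne hq1 with hlt | hgt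
  · have h1 : ‖-(q • R)‖ < 1 := by
      rw [norm_neg, norm_smul, Real.norm_of_nonneg hq.le]
      nlinarith [norm_nonneg R]
    simpa using isUnit_one_sub_of_norm_lt_one h1
  · have h1 : ‖-(q⁻¹ • R')‖ < 1 := by
      rw [norm_neg, norm_smul, Real.norm_of_nonneg (by positivity)]
      have := inv_lt_one_of_one_lt₀ hgt
      have : 0 < q⁻¹ := by positivity
      nlinarith [norm_nonneg R']
    have h2 := isUnit_one_sub_of_norm_lt_one h1
    have h3 : IsUnit (q • R) := ⟨⟨q • R, q⁻¹ • R', by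
      rw [smul_mul_smul_comm, h, mul_inv_cancel₀ hq.ne', one_smul], by
      rw [smul_mul_smul_comm, h', inv_mul_cancel₀ hq.ne', one_smul]⟩, rfl⟩
    have h4 : 1 + q • R = (q • R) * (1 - -(q⁻¹ • R')) := by
      rw [sub_neg_eq_add, mul_add, mul_one, smul_mul_smul_comm, h, mul_inv_cancel₀ hq.ne',
        one_smul, add_comm]
    rw [h4]
    exact h3.mul h2

/-- If `C³ = -qRC`, with `R` commuting with `C` and `1 + qR` invertible, then `1 - C` is
invertible, because `(1 - C)(1 + qR + C + C²) = 1 + qR`. -/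
lemma isUnit_one_sub_of_cube {V : Type*} [NormedAddCommGroup V] [NormedSpace ℝ V]
    {C R : V →L[ℝ] V} {q : ℝ} (hcomm : Commute R C) (hC : C * C * C = -(q • R) * C)
    (hu : IsUnit (1 + q • R)) : IsUnit (1 - C) := by
  have hc : Commute (q • R) C := hcomm.smul_left q
  set S := q • R
  have e : (1 - C) * (1 + S + C + C * C) = 1 + S := by
    have : (1 - C) * (1 + S + C + C * C) = 1 + S - C * S - C * C * C := by noncomm_ring
    rw [this, hC, ← hc.eq, neg_mul]
    abel
  have hcm : Commute (1 - C) (1 + S + C + C * C) := by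
    have c1 : Commute C (1 + S + C + C * C) :=
      (((Commute.one_right C).add_right hc.symm).add_right (Commute.refl C)).add_right
        ((Commute.refl C).mul_right (Commute.refl C))
    exact (Commute.one_left _).sub_left c1
  rw [← e] at hu
  exact (hcm.isUnit_mul_iff.1 hu).1

end Algebra

/-! ### Reflection and sweep operators of the hyperbolic system -/

section Transport

variable (r : C(UnitI, ℝ))

/-- Multiplication by `m` after the translation in time by `κ α(x)`, where `α` is the primitive
of `r`. Up to the factor `m`, functions of `t` alone become functions that are constant along the
characteristics `t + κ α(x) = const`. -/
def transport (m : C(UnitI, ℝ)) (κ : ℝ) : CylFun →L[ℝ] CylFun :=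
  mulX m ∘L shear (κ • primitive r)

/-- Integration in `x` from the left end of the transported function. -/
def volterra (m : C(UnitI, ℝ)) (κ : ℝ) : CylFun →L[ℝ] CylFun :=
  integrateX ∘L transport r m κ

lemma lipschitzInX_volterra (m : C(UnitI, ℝ)) (κ : ℝ) : LipschitzInX (volterra r m κ) :=
  lipschitzInX_integrateX.comp _

/-- Translation in time by the constant `c`. -/
def shift (c : ℝ) : CylFun →L[ℝ] CylFun := shear (ContinuousMap.const UnitI c)

@[simp] lemma shift_apply (c : ℝ) (f : CylFun) (t : Circ) (x : UnitI) :
    shift c f (t, x) = f (t + (c : Circ), x) := rfl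

lemma LipschitzInX.shift_comp {H : CylFun →L[ℝ] CylFun} (hH : LipschitzInX H) (c : ℝ) :
    LipschitzInX (shift c ∘L H) := by
  obtain ⟨L, hL, h⟩ := hH
  exact ⟨L, hL, fun f t x y => h f _ x y⟩

variable {r}

lemma isCompactOperator_volterra_mulX (hr : ∀ x, 0 < r x) (m b : C(UnitI, ℝ)) {κ : ℝ}
    (hκ : κ ≠ 0) {H : CylFun →L[ℝ] CylFun} (hH : LipschitzInX H) :
    IsCompactOperator (volterra r m κ ∘L mulX b ∘L H) := by
  have e : volterra r m κ ∘L mulX b ∘L H =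
      integrateX ∘L mulX (m * b) ∘L shear (κ • primitive r) ∘L H := by
    have : transport r m κ ∘L mulX b = mulX (m * b) ∘L shear (κ • primitive r) := by
      ext f ⟨t, x⟩
      exact (mul_assoc _ _ _).symm
    rw [volterra, ContinuousLinearMap.comp_assoc,
      ← ContinuousLinearMap.comp_assoc (transport r m κ), this]
    rfl
  rw [e]
  exact isCompactOperator_integrateX_shear r (m * b) hr hκ hH

/-- Transport followed by integration along a second family of characteristics. The translations in
time add up to `(κ + κ') α`, and `κ + κ' ≠ 0` says that the two families are transversal. -/
lemma isCompactOperator_volterra_transport (hr : ∀ x, 0 < r x) (m b m' : C(UnitI, ℝ)) {κ κ' : ℝ}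
    (hκ : κ + κ' ≠ 0) {H : CylFun →L[ℝ] CylFun} (hH : LipschitzInX H) :
    IsCompactOperator (volterra r m κ ∘L mulX b ∘L transport r m' κ' ∘L H) := by
  have e : volterra r m κ ∘L mulX b ∘L transport r m' κ' ∘L H =
      integrateX ∘L mulX (m * b * m') ∘L shear ((κ + κ') • primitive r) ∘L H := by
    have : transport r m κ ∘L mulX b ∘L transport r m' κ' =
        mulX (m * b * m') ∘L shear ((κ + κ') • primitive r) := by
      ext f ⟨t, x⟩
      change m x * (b x * (m' x * f (t + ((κ * primitive r x : ℝ) : Circ) +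
        ((κ' * primitive r x : ℝ) : Circ), x))) =
        m x * b x * m' x * f (t + (((κ + κ') * primitive r x : ℝ) : Circ), x)
      rw [add_mul, AddCircle.coe_add, add_assoc t]
      ring
    have h2 : volterra r m κ ∘L mulX b ∘L transport r m' κ' ∘L H =
        integrateX ∘L (transport r m κ ∘L mulX b ∘L transport r m' κ') ∘L H := rfl
    rw [h2, this]
    rfl
  rw [e]
  exact isCompactOperator_integrateX_shear r (m * b * m') hr hκ hH

end Transport

section System

variable (r : C(UnitI, ℝ))

/-- The boundary operator at `x = 0`: the trace there is carried into the strip and damped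
by `u`. -/
def reflectLeft (u : C(UnitI, ℝ)) (ω : ℝ) : CylFun →L[ℝ] CylFun :=
  transport r u ω ∘L traceAt 0

/-- The boundary operator at `x = 1`. The translation by `ω α(1)` is there because `α` is normalized
at `x = 0`, whereas the characteristics through `(t, x)` are followed up to `x = 1`. -/
def reflectRight (w : C(UnitI, ℝ)) (ω : ℝ) : CylFun →L[ℝ] CylFun :=
  transport r w (-ω) ∘L shift (ω * primitive r 1) ∘L traceAt 1

/-- Integration from `x = 0` along the characteristics used by `reflectLeft`, with density `m`. -/
def sweepLeft (u m : C(UnitI, ℝ)) (ω : ℝ) : CylFun →L[ℝ] CylFun :=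
  transport r u ω ∘L volterra r m (-ω)

/-- Integration up to `x = 1` along the characteristics used by `reflectRight`, with density `m`;
the integral from `x` to `1` is the difference of the ones from `0` to `1` and from `0` to `x`. -/
def sweepRight (w m : C(UnitI, ℝ)) (ω : ℝ) : CylFun →L[ℝ] CylFun :=
  transport r w (-ω) ∘L (traceAt 1 - ContinuousLinearMap.id ℝ CylFun) ∘L volterra r m ω

variable {r}

lemma primitive_zero : primitive r 0 = 0 := by
  simp [primitive_apply]

lemma isCompactOperator_sweepLeft (hr : ∀ x, 0 < r x) (u m b : C(UnitI, ℝ)) {ω : ℝ}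
    (hω : ω ≠ 0) {H : CylFun →L[ℝ] CylFun} (hH : LipschitzInX H) :
    IsCompactOperator (sweepLeft r u m ω ∘L mulX b ∘L H) :=
  (isCompactOperator_volterra_mulX hr m b (neg_ne_zero.2 hω) hH).clm_comp (transport r u ω)

lemma isCompactOperator_sweepRight (hr : ∀ x, 0 < r x) (w m b : C(UnitI, ℝ)) {ω : ℝ}
    (hω : ω ≠ 0) {H : CylFun →L[ℝ] CylFun} (hH : LipschitzInX H) :
    IsCompactOperator (sweepRight r w m ω ∘L mulX b ∘L H) :=
  (isCompactOperator_volterra_mulX hr m b hω hH).clm_comp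
    (transport r w (-ω) ∘L (traceAt 1 - ContinuousLinearMap.id ℝ CylFun))

lemma isCompactOperator_sweepLeft_transport (hr : ∀ x, 0 < r x) (u m b w : C(UnitI, ℝ)) {ω : ℝ}
    (hω : ω ≠ 0) {H : CylFun →L[ℝ] CylFun} (hH : LipschitzInX H) :
    IsCompactOperator (sweepLeft r u m ω ∘L mulX b ∘L transport r w (-ω) ∘L H) :=
  (isCompactOperator_volterra_transport hr m b w (κ := -ω) (κ' := -ω)
    (by rw [← two_mul]; exact mul_ne_zero two_ne_zero (neg_ne_zero.2 hω)) hH).clm_comp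
    (transport r u ω)

lemma isCompactOperator_sweepRight_transport (hr : ∀ x, 0 < r x) (w m b u : C(UnitI, ℝ)) {ω : ℝ}
    (hω : ω ≠ 0) {H : CylFun →L[ℝ] CylFun} (hH : LipschitzInX H) :
    IsCompactOperator (sweepRight r w m ω ∘L mulX b ∘L transport r u ω ∘L H) :=
  (isCompactOperator_volterra_transport hr m b u (κ := ω) (κ' := ω)
    (by rw [← two_mul]; exact mul_ne_zero two_ne_zero hω) hH).clm_comp
    (transport r w (-ω) ∘L (traceAt 1 - ContinuousLinearMap.id ℝ CylFun))

lemma lipschitzInX_trace_sub_comp_volterra (m : C(UnitI, ℝ)) (κ : ℝ) :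
    LipschitzInX ((traceAt 1 - ContinuousLinearMap.id ℝ CylFun) ∘L volterra r m κ) := by
  have h := ((lipschitzInX_traceAt 1).comp (volterra r m κ)).sub
    (lipschitzInX_volterra r m κ)
  exact h

lemma norm_shift_le (c : ℝ) : ‖shift c‖ ≤ 1 := norm_pull_le _

lemma shift_comp_shift_neg (c : ℝ) : shift c ∘L shift (-c) = ContinuousLinearMap.id ℝ CylFun := by
  ext f ⟨t, x⟩
  simp only [ContinuousLinearMap.comp_apply, shift_apply, ContinuousLinearMap.id_apply,
    add_assoc, ← AddCircle.coe_add]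
  simp

/-- If one round trip changes the amplitude by a factor `-q` with `q ≠ 1`, then the problem with
reflections alone is uniquely solvable: it reduces to an equation `v + q R v = g` with a time
translation `R`. -/
lemma isUnit_one_sub_reflect (u w : C(UnitI, ℝ)) (ω : ℝ) {q : ℝ} (hq : 0 < q) (hq1 : q ≠ 1)
    (hqe : w 0 * u 1 = -q) :
    IsUnit (1 - offDiag (reflectLeft r u ω) (reflectRight r w ω)) := by
  set c := ω * primitive r 1 with hc
  have hS : ∀ d, ‖(shift d).prodMap (shift d)‖ ≤ 1 := by
    intro d
    refine ContinuousLinearMap.opNorm_le_bound _ zero_le_one fun z => ?_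
    have h1 : ∀ f : CylFun, ‖shift d f‖ ≤ ‖f‖ := fun f => by
      simpa using (shift d).le_of_opNorm_le (norm_shift_le d) f
    rw [one_mul]
    exact max_le_max (h1 z.1) (h1 z.2)
  have hSS : ∀ d, (shift d).prodMap (shift d) * (shift (-d)).prodMap (shift (-d)) = 1 := by
    intro d
    have h1 := fun f => congrArg (fun P : CylFun →L[ℝ] CylFun => P f) (shift_comp_shift_neg d)
    exact ContinuousLinearMap.ext fun z => Prod.ext (h1 z.1) (h1 z.2)
  have hu := isUnit_one_add_smul (hS (2 * c)) (hS (-(2 * c))) (hSS (2 * c))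
    (by simpa using hSS (-(2 * c))) hq hq1
  have h2c : ((2 * c : ℝ) : Circ) = (c : Circ) + (c : Circ) := by
    rw [← AddCircle.coe_add, two_mul c]
  refine isUnit_one_sub_of_cube (q := q) ?_ ?_ hu
  · refine ContinuousLinearMap.ext fun z => Prod.ext ?_ ?_
    · ext ⟨t, x⟩
      change u x * z.2 (t + ((2 * c : ℝ) : Circ) + ((ω * primitive r x : ℝ) : Circ), 0) =
        u x * z.2 (t + ((ω * primitive r x : ℝ) : Circ) + ((2 * c : ℝ) : Circ), 0)
      rw [add_right_comm]
    · ext ⟨t, x⟩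
      change w x * z.1 (t + ((2 * c : ℝ) : Circ) + ((-ω * primitive r x : ℝ) : Circ) +
          (c : Circ), 1) =
        w x * z.1 (t + ((-ω * primitive r x : ℝ) : Circ) + (c : Circ) + ((2 * c : ℝ) : Circ), 1)
      congr 3
      abel
  -- three reflections amount to one, times `w 0 * u 1` and translated in time by the
  -- duration `2 * c` of a round trip
  · refine ContinuousLinearMap.ext fun z => Prod.ext ?_ ?_
    · ext ⟨t, x⟩
      change u x * (w 0 * (u 1 * z.2 (t + ((ω * primitive r x : ℝ) : Circ) +
          ((-ω * primitive r 0 : ℝ) : Circ) + (c : Circ) + (c : Circ), 0))) =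
        -(q * (u x * z.2 (t + ((2 * c : ℝ) : Circ) + ((ω * primitive r x : ℝ) : Circ), 0)))
      rw [primitive_zero, mul_zero, AddCircle.coe_zero, add_zero, h2c,
        show ∀ y : ℝ, u x * (w 0 * (u 1 * y)) = w 0 * u 1 * (u x * y) by intro y; ring, hqe,
        neg_mul]
      congr 5
      abel
    · ext ⟨t, x⟩
      change w x * (u 1 * (w 0 * z.1 (t + ((-ω * primitive r x : ℝ) : Circ) + (c : Circ) +
          (c : Circ) + ((-ω * primitive r 0 : ℝ) : Circ) + (c : Circ), 1))) =
        -(q * (w x * z.1 (t + ((2 * c : ℝ) : Circ) + ((-ω * primitive r x : ℝ) : Circ) +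
          (c : Circ), 1)))
      rw [primitive_zero, mul_zero, AddCircle.coe_zero, add_zero, h2c,
        show ∀ y : ℝ, w x * (u 1 * (w 0 * y)) = w 0 * u 1 * (w x * y) by intro y; ring, hqe,
        neg_mul]
      congr 5
      abel

/-- A hyperbolic system in characteristic form, with reflections at both ends, is an invertible
operator minus a compact one. Its zero-order terms are the off-diagonal coupling by `p₁` and `p₂`
and the integral terms `N`, where `G` is an arbitrary bounded operator. The diagonal coupling has
been absorbed into the damping factors. -/
theorem exists_isUnit_sub_compact (hr : ∀ x, 0 < r x) {ω : ℝ} (hω : ω ≠ 0)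
    (u w w' m₁ m₂ p₁ p₂ p₃ p₄ : C(UnitI, ℝ)) (s : ℝ) (G : CylPair →L[ℝ] CylFun)
    {q : ℝ} (hq : 0 < q) (hq1 : q ≠ 1) (hqe : w 0 * u 1 = -q) {N : CylPair →L[ℝ] CylFun}
    (hN : N = mulX p₃ ∘L integrateX ∘L G + mulX p₄ ∘L (shift s ∘L integrateX) ∘L G) :
    ∃ Q K : CylPair →L[ℝ] CylPair, IsUnit Q ∧ IsCompactOperator K ∧
      1 - offDiag (reflectLeft r u ω) (reflectRight r w ω) -
        ((sweepLeft r u m₁ ω).prodMap (sweepRight r w' m₂ ω)) ∘L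
          (offDiag (mulX p₂) (mulX p₁) + N.prod N) = Q - K := by
  set C₁ := reflectLeft r u ω with hC₁
  set C₂ := reflectRight r w ω with hC₂
  set D₁ := sweepLeft r u m₁ ω with hD₁
  set D₂ := sweepRight r w' m₂ ω with hD₂
  -- `x` and `y` square to zero; with the products `x * y`, `x * C`, `y * C` and `D N` compact, the
  -- operator is `1 - x - y - C`, and hence `(1 - x) * (1 - y) * (1 - C)`, up to a compact one
  set x := offDiag (D₁ ∘L mulX p₂) 0
  set y := offDiag 0 (D₂ ∘L mulX p₁)
  set C := offDiag C₁ C₂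
  have hx : IsUnit (1 - x) := isUnit_one_sub_of_sq_eq_zero (by
    ext z <;> simp [x])
  have hy : IsUnit (1 - y) := isUnit_one_sub_of_sq_eq_zero (by
    ext z <;> simp [y])
  have hC : IsUnit (1 - C) := isUnit_one_sub_reflect u w ω hq hq1 hqe
  -- compactness of the error terms
  have k1 : IsCompactOperator (D₁ ∘L N) := by
    have e : D₁ ∘L N = (D₁ ∘L mulX p₃ ∘L integrateX) ∘L G +
        (D₁ ∘L mulX p₄ ∘L (shift s ∘L integrateX)) ∘L G := by
      rw [hN, ContinuousLinearMap.comp_add]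
      rfl
    rw [e]
    exact ((isCompactOperator_sweepLeft hr u m₁ p₃ hω lipschitzInX_integrateX).comp_clm G).add
      ((isCompactOperator_sweepLeft hr u m₁ p₄ hω
        (lipschitzInX_integrateX.shift_comp s)).comp_clm G)
  have k2 : IsCompactOperator (D₂ ∘L N) := by
    have e : D₂ ∘L N = (D₂ ∘L mulX p₃ ∘L integrateX) ∘L G +
        (D₂ ∘L mulX p₄ ∘L (shift s ∘L integrateX)) ∘L G := by
      rw [hN, ContinuousLinearMap.comp_add]
      rfl
    rw [e]
    exact ((isCompactOperator_sweepRight hr w' m₂ p₃ hω lipschitzInX_integrateX).comp_clm G).add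
      ((isCompactOperator_sweepRight hr w' m₂ p₄ hω
        (lipschitzInX_integrateX.shift_comp s)).comp_clm G)
  have k3 : IsCompactOperator (D₁ ∘L mulX p₂ ∘L C₂) :=
    isCompactOperator_sweepLeft_transport hr u m₁ p₂ w hω ((lipschitzInX_traceAt 1).shift_comp _)
  have k4 : IsCompactOperator (D₂ ∘L mulX p₁ ∘L C₁) :=
    isCompactOperator_sweepRight_transport hr w' m₂ p₁ u hω (lipschitzInX_traceAt 0)
  have k5 : IsCompactOperator (D₁ ∘L mulX p₂ ∘L D₂) :=
    isCompactOperator_sweepLeft_transport hr u m₁ p₂ w' hω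
      (lipschitzInX_trace_sub_comp_volterra m₂ ω)
  have k6 : IsCompactOperator (((D₁ ∘L mulX p₂ ∘L D₂) ∘L mulX p₁).prodMap
      (0 : CylFun →L[ℝ] CylFun)) :=
    isCompactOperator_prodMap (k5.comp_clm (mulX p₁)) isCompactOperator_zero
  refine ⟨(1 - x) * (1 - y) * (1 - C),
    (D₁ ∘L N).prod (D₂ ∘L N) + (D₁ ∘L mulX p₂ ∘L C₂).prodMap (D₂ ∘L mulX p₁ ∘L C₁) +
      (((D₁ ∘L mulX p₂ ∘L D₂) ∘L mulX p₁).prodMap (0 : CylFun →L[ℝ] CylFun)) ∘L (1 - C),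
    (hx.mul hy).mul hC,
    ((isCompactOperator_prod k1 k2).add (isCompactOperator_prodMap k3 k4)).add
      (k6.comp_clm (1 - C)), ?_⟩
  refine ContinuousLinearMap.ext fun z => Prod.ext ?_ ?_
  · simp [x, y, C]
    abel
  · simp [x, y, C]
    abel

end System

/-! ### The operators of the wave equation on the cylinder -/

/-- The restriction to `[0,1]` of a function that is continuous there, as a continuous map. -/
def onUnit (g : ℝ → ℝ) (hg : ContinuousOn g (Icc (0 : ℝ) 1)) : C(UnitI, ℝ) :=
  ⟨fun x => g x, continuousOn_iff_continuous_domRestrict.1 hg⟩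

@[simp] lemma onUnit_apply {g : ℝ → ℝ} {hg : ContinuousOn g (Icc (0 : ℝ) 1)} (x : UnitI) :
    onUnit g hg x = g x := rfl

lemma onUnit_clamp {g : ℝ → ℝ} {hg : ContinuousOn g (Icc (0 : ℝ) 1)} {ξ : ℝ}
    (hξ : ξ ∈ Icc (0 : ℝ) 1) : onUnit g hg (clamp ξ) = g ξ := by
  rw [onUnit_apply, clamp, projIcc_of_mem zero_le_one hξ]

lemma integral_eq_primitive_sub {g : ℝ → ℝ} (hg : ContinuousOn g (Icc (0 : ℝ) 1)) (x ξ : UnitI) :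
    ∫ η in (ξ : ℝ)..x, g η = primitive (onUnit g hg) x - primitive (onUnit g hg) ξ := by
  have hc : Continuous fun ξ => onUnit g hg (clamp ξ) :=
    (onUnit g hg).continuous.comp continuous_clamp
  rw [primitive_apply, primitive_apply, intervalIntegral.integral_interval_sub_left
    (hc.intervalIntegrable _ _) (hc.intervalIntegrable _ _)]
  refine intervalIntegral.integral_congr fun η hη => ?_
  exact (onUnit_clamp (uIcc_subset_Icc ξ.2 x.2 hη)).symm

/-- The exponential of the primitive of `r` that vanishes at `0`. -/
def expPrimitive (r : C(UnitI, ℝ)) : C(UnitI, ℝ) :=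
  ⟨fun x => Real.exp (primitive r x), by fun_prop⟩

lemma expPrimitive_apply (r : C(UnitI, ℝ)) (x : UnitI) :
    expPrimitive r x = Real.exp (primitive r x) := rfl

lemma expPrimitive_pos (r : C(UnitI, ℝ)) (x : UnitI) : 0 < expPrimitive r x := Real.exp_pos _

lemma expPrimitive_zero (r : C(UnitI, ℝ)) : expPrimitive r 0 = 1 := by
  rw [expPrimitive_apply, primitive_zero, Real.exp_zero]

/-- The pointwise reciprocal of a positive function. -/
def recip (r : C(UnitI, ℝ)) (hr : ∀ x, 0 < r x) : C(UnitI, ℝ) :=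
  ⟨fun x => (r x)⁻¹, r.continuous.inv₀ fun x => (hr x).ne'⟩

namespace WaveData

variable (W : WaveData) (l : ℝ)

/-- The reciprocal `1 / a(·,l)` of the wave speed. -/
def slowness : C(UnitI, ℝ) :=
  onUnit (fun x => 1 / W.a x l) (continuousOn_const.div (W.a_cont l) (W.a_ne l))

lemma slowness_apply (x : UnitI) : W.slowness l x = 1 / W.a x l := rfl

lemma slowness_pos (x : UnitI) : 0 < W.slowness l x := one_div_pos.2 (W.a_pos x x.2 l)

lemma A_eq (x ξ : UnitI) :
    W.A x ξ l = primitive (W.slowness l) x - primitive (W.slowness l) ξ :=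
  integral_eq_primitive_sub _ x ξ

lemma b₁_div_a_cont : ContinuousOn (fun x => W.b₁ x l / W.a x l) (Icc (0 : ℝ) 1) :=
  (W.b₁_cont l).div (W.a_cont l) (W.a_ne l)

lemma b₂_div_a_cont : ContinuousOn (fun x => W.b₂ x l / W.a x l) (Icc (0 : ℝ) 1) :=
  (W.b₂_cont l).div (W.a_cont l) (W.a_ne l)

/-- The integrating factor `exp ∫₀ˣ b₁ / a` of the first characteristic equation. -/
def growth₁ : C(UnitI, ℝ) :=
  expPrimitive (onUnit _ (W.b₁_div_a_cont l))

/-- The integrating factor `exp ∫₀ˣ b₂ / a` of the second characteristic equation. -/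
def growth₂ : C(UnitI, ℝ) :=
  expPrimitive (onUnit _ (W.b₂_div_a_cont l))

lemma growth₁_pos (x : UnitI) : 0 < W.growth₁ l x := expPrimitive_pos _ x

lemma growth₂_pos (x : UnitI) : 0 < W.growth₂ l x := expPrimitive_pos _ x

lemma c₁_eq (x ξ : UnitI) : W.c₁ x ξ l = W.growth₁ l ξ * (W.growth₁ l x)⁻¹ := by
  rw [c₁, growth₁, expPrimitive_apply, expPrimitive_apply, ← Real.exp_neg, ← Real.exp_add,
    integral_eq_primitive_sub (W.b₁_div_a_cont l) ξ x, sub_eq_add_neg]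

lemma c₂_eq (x ξ : UnitI) : W.c₂ x ξ l = W.growth₂ l x * (W.growth₂ l ξ)⁻¹ := by
  rw [c₂, growth₂, expPrimitive_apply, expPrimitive_apply, ← Real.exp_neg, ← Real.exp_add,
    integral_eq_primitive_sub (W.b₂_div_a_cont l) x ξ, sub_eq_add_neg]

/-- The factor `-c₁(x,0,l)` of the reflection at `x = 0`, which is also the `x`-dependent factor of
the kernel of `D₁`. -/
def leftFactor : C(UnitI, ℝ) := -recip (W.growth₁ l) (W.growth₁_pos l)

/-- The factor `c₂(x,1,l)` of the reflection at `x = 1`. -/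
def rightFactor : C(UnitI, ℝ) := (W.growth₂ l 1)⁻¹ • W.growth₂ l

/-- The `ξ`-dependent factor of the kernel `-c₁(x,ξ,l) / a(ξ,l)` of `D₁`; the other one is
`leftFactor`. -/
def leftDensity : C(UnitI, ℝ) := W.growth₁ l * W.slowness l

/-- The `ξ`-dependent factor of the kernel `c₂(x,ξ,l) / a(ξ,l)` of `D₂`; the other one is
`growth₂`. -/
def rightDensity : C(UnitI, ℝ) := recip (W.growth₂ l) (W.growth₂_pos l) * W.slowness l

lemma fstC_opC (ω : ℝ) (v : C2pi) (t : ℝ) (x : UnitI) :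
    fstC (W.opC ω l v) t x = W.C₁ ω l v t x := by
  change W.C₁ ω l v t (clamp x) = _
  rw [clamp_coe]

lemma sndC_opC (ω : ℝ) (v : C2pi) (t : ℝ) (x : UnitI) :
    sndC (W.opC ω l v) t x = W.C₂ ω l v t x := by
  change W.C₂ ω l v t (clamp x) = _
  rw [clamp_coe]

lemma fstC_opD (ω : ℝ) (v : C2pi) (t : ℝ) (x : UnitI) :
    fstC (W.opD ω l v) t x = W.D₁ ω l v t x := by
  change W.D₁ ω l v t (clamp x) = _
  rw [clamp_coe]

lemma sndC_opD (ω : ℝ) (v : C2pi) (t : ℝ) (x : UnitI) :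
    sndC (W.opD ω l v) t x = W.D₂ ω l v t x := by
  change W.D₂ ω l v t (clamp x) = _
  rw [clamp_coe]

lemma cylEquiv_opC (ω : ℝ) (v : C2pi) :
    cylEquiv (W.opC ω l v) =
      offDiag (reflectLeft (W.slowness l) (W.leftFactor l) ω)
        (reflectRight (W.slowness l) (W.rightFactor l) ω) (cylEquiv v) := by
  refine Prod.ext (cylFun_ext fun t x => ?_) (cylFun_ext fun t x => ?_)
  · rw [cylEquiv_fst, fstC_opC]
    change _ = -(W.growth₁ l x)⁻¹ *
      (cylEquiv v).2 ((t : Circ) + ((ω * primitive (W.slowness l) x : ℝ) : Circ), 0)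
    rw [← AddCircle.coe_add, cylEquiv_snd, C₁]
    have h1 := W.c₁_eq l x 0
    have h2 := W.A_eq l x 0
    rw [primitive_zero, sub_zero] at h2
    rw [growth₁, expPrimitive_zero, one_mul] at h1
    simp only [Icc.coe_zero] at h1 h2 ⊢
    rw [h1, h2, growth₁]
  · rw [cylEquiv_snd, sndC_opC]
    change _ = (W.growth₂ l 1)⁻¹ * W.growth₂ l x *
      (cylEquiv v).1 ((t : Circ) + ((-ω * primitive (W.slowness l) x : ℝ) : Circ) +
        ((ω * primitive (W.slowness l) 1 : ℝ) : Circ), 1)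
    rw [← AddCircle.coe_add, ← AddCircle.coe_add, cylEquiv_fst, C₂]
    have h1 := W.c₂_eq l x 1
    have h2 := W.A_eq l x 1
    simp only [Icc.coe_one] at h1 h2 ⊢
    rw [h1, h2, mul_comm (W.growth₂ l x)]
    congr 2
    ring

lemma cylEquiv_opD (ω : ℝ) (v : C2pi) :
    cylEquiv (W.opD ω l v) =
      ((sweepLeft (W.slowness l) (W.leftFactor l) (W.leftDensity l) ω).prodMap
        (sweepRight (W.slowness l) (W.growth₂ l) (W.rightDensity l) ω)) (cylEquiv v) := by
  set α := primitive (W.slowness l) with hα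
  refine Prod.ext (cylFun_ext fun t x => ?_) (cylFun_ext fun t x => ?_)
  · rw [cylEquiv_fst, fstC_opD]
    change _ = -(W.growth₁ l x)⁻¹ *
      ∫ ξ in (0 : ℝ)..x, W.growth₁ l (clamp ξ) * W.slowness l (clamp ξ) *
        (cylEquiv v).1 ((t : Circ) + ((ω * α x : ℝ) : Circ) +
          ((-ω * α (clamp ξ) : ℝ) : Circ), clamp ξ)
    rw [D₁, neg_mul, ← intervalIntegral.integral_const_mul]
    congr 1
    refine intervalIntegral.integral_congr fun ξ hξ => ?_
    have hξ' : ξ ∈ Icc (0 : ℝ) 1 := uIcc_subset_Icc (by simp) x.2 hξ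
    obtain ⟨ξ, rfl⟩ : ∃ z : UnitI, (z : ℝ) = ξ := ⟨⟨ξ, hξ'⟩, rfl⟩
    simp only [clamp_coe, ← AddCircle.coe_add]
    rw [cylEquiv_fst, c₁_eq, A_eq, slowness_apply,
      show t + ω * (α x - α ξ) = t + ω * α x + -ω * α ξ by ring]
    ring
  · rw [cylEquiv_snd, sndC_opD]
    change _ = W.growth₂ l x *
      ((∫ ξ in (0 : ℝ)..(1 : UnitI), (W.growth₂ l (clamp ξ))⁻¹ * W.slowness l (clamp ξ) *
        (cylEquiv v).2 ((t : Circ) + ((-ω * α x : ℝ) : Circ) +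
          ((ω * α (clamp ξ) : ℝ) : Circ), clamp ξ)) -
      ∫ ξ in (0 : ℝ)..x, (W.growth₂ l (clamp ξ))⁻¹ * W.slowness l (clamp ξ) *
        (cylEquiv v).2 ((t : Circ) + ((-ω * α x : ℝ) : Circ) +
          ((ω * α (clamp ξ) : ℝ) : Circ), clamp ξ))
    have hcl := continuous_clamp
    have hmk : Continuous fun y : ℝ => (y : Circ) := AddCircle.continuous_mk' _
    have hc : Continuous fun ξ : ℝ => (W.growth₂ l (clamp ξ))⁻¹ * W.slowness l (clamp ξ) *
        (cylEquiv v).2 ((t : Circ) + ((-ω * α x : ℝ) : Circ) +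
          ((ω * α (clamp ξ) : ℝ) : Circ), clamp ξ) := by
      refine Continuous.mul (Continuous.mul (Continuous.inv₀ (by fun_prop)
        fun ξ => (W.growth₂_pos l _).ne') (by fun_prop)) (by fun_prop)
    rw [intervalIntegral.integral_interval_sub_left (hc.intervalIntegrable _ _)
      (hc.intervalIntegrable _ _), D₂, ← intervalIntegral.integral_const_mul]
    refine intervalIntegral.integral_congr fun ξ hξ => ?_
    have hξ' : ξ ∈ Icc (0 : ℝ) 1 := uIcc_subset_Icc x.2 (by simp) hξ
    obtain ⟨ξ, rfl⟩ : ∃ z : UnitI, (z : ℝ) = ξ := ⟨⟨ξ, hξ'⟩, rfl⟩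
    simp only [clamp_coe, ← AddCircle.coe_add]
    rw [cylEquiv_snd, c₂_eq, A_eq, slowness_apply,
      show t - ω * (α x - α ξ) = t + -ω * α x + ω * α ξ by ring]
    ring

end WaveData

/-! ### The derivative of the nonlinearity at zero -/

namespace WaveData

variable (W : WaveData) (l : ℝ)

/-- Derivative of `b(x,l,·)` at `y`. -/
def bGrad (x : ℝ) (y : ℝ × ℝ × ℝ × ℝ) : ℝ × ℝ × ℝ × ℝ →L[ℝ] ℝ :=
  (fderivWithin ℝ (fun p : ℝ × ℝ × ℝ × ℝ × ℝ × ℝ =>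
      W.b p.1 p.2.1 p.2.2.1 p.2.2.2.1 p.2.2.2.2.1 p.2.2.2.2.2) (Icc (0 : ℝ) 1 ×ˢ univ)
      (x, l, y)) ∘L (ContinuousLinearMap.inr ℝ ℝ (ℝ × ℝ × ℝ × ℝ × ℝ)) ∘L
      (ContinuousLinearMap.inr ℝ ℝ (ℝ × ℝ × ℝ × ℝ))

lemma continuousOn_bGrad :
    ContinuousOn (fun p : (ℝ × ℝ) × ℝ × ℝ × ℝ × ℝ => W.bGrad p.1.2 p.1.1 p.2)
      ((Icc (0 : ℝ) 1 ×ˢ univ) ×ˢ univ) := by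
  have hu : UniqueDiffOn ℝ (Icc (0 : ℝ) 1 ×ˢ (univ : Set (ℝ × ℝ × ℝ × ℝ × ℝ))) :=
    (uniqueDiffOn_Icc zero_lt_one).prod uniqueDiffOn_univ
  have hd := W.b_smooth.continuousOn_fderivWithin hu (by simp)
  have h2 := hd.comp (f := fun p : (ℝ × ℝ) × ℝ × ℝ × ℝ × ℝ => (p.1.1, p.1.2, p.2))
    (s := (Icc (0 : ℝ) 1 ×ˢ univ) ×ˢ univ) (by fun_prop) (fun p hp => ⟨hp.1.1, mem_univ _⟩)
  exact h2.clm_comp continuousOn_const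

lemma hasFDerivAt_b {x : ℝ} (hx : x ∈ Icc (0 : ℝ) 1) (y : ℝ × ℝ × ℝ × ℝ) :
    HasFDerivAt (fun y : ℝ × ℝ × ℝ × ℝ => W.b x l y.1 y.2.1 y.2.2.1 y.2.2.2) (W.bGrad l x y) y := by
  have hdiff := (W.b_smooth.differentiableOn (by simp) (x, l, y)
    ⟨hx, mem_univ _⟩).hasFDerivWithinAt
  have hin : HasFDerivAt (fun y : ℝ × ℝ × ℝ × ℝ => (x, l, y))
      ((ContinuousLinearMap.inr ℝ ℝ (ℝ × ℝ × ℝ × ℝ × ℝ)) ∘L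
      (ContinuousLinearMap.inr ℝ ℝ (ℝ × ℝ × ℝ × ℝ))) y := by
    exact (hasFDerivAt_prodMk_right x (l, y)).comp y (hasFDerivAt_prodMk_right l y)
  exact HasFDerivWithinAt.comp_hasFDerivAt (t := Icc (0 : ℝ) 1 ×ˢ univ) y hdiff hin
    (Filter.Eventually.of_forall fun z => ⟨hx, mem_univ _⟩)

lemma bGrad_line {x : ℝ} (hx : x ∈ Icc (0 : ℝ) 1) (e : ℝ × ℝ × ℝ × ℝ) :
    deriv (fun s : ℝ => W.b x l (s * e.1) (s * e.2.1) (s * e.2.2.1) (s * e.2.2.2)) 0 =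
      W.bGrad l x 0 e := by
  have hline : HasDerivAt (fun s : ℝ => (s * e.1, s * e.2.1, s * e.2.2.1, s * e.2.2.2)) e 0 := by
    refine HasDerivAt.prodMk ?_ (HasDerivAt.prodMk ?_ (HasDerivAt.prodMk ?_ ?_)) <;>
    exact hasDerivAt_mul_const _
  have h := HasFDerivAt.comp_hasDerivAt_of_eq (0 : ℝ) (W.hasFDerivAt_b l hx 0) hline
    (by simp only [zero_mul]; rfl)
  exact h.deriv

lemma bGrad_zero_apply {x : ℝ} (hx : x ∈ Icc (0 : ℝ) 1) (y : ℝ × ℝ × ℝ × ℝ) :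
    W.bGrad l x 0 y =
      W.b₃ x l * y.1 + W.b₄ x l * y.2.1 + W.b₅ x l * y.2.2.1 + W.b₆ x l * y.2.2.2 := by
  have h3 : W.b₃ x l = W.bGrad l x 0 (1, 0, 0, 0) := by
    simpa [b₃] using W.bGrad_line l hx (1, 0, 0, 0)
  have h4 : W.b₄ x l = W.bGrad l x 0 (0, 1, 0, 0) := by
    simpa [b₄] using W.bGrad_line l hx (0, 1, 0, 0)
  have h5 : W.b₅ x l = W.bGrad l x 0 (0, 0, 1, 0) := by
    simpa [b₅] using W.bGrad_line l hx (0, 0, 1, 0)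
  have h6 : W.b₆ x l = W.bGrad l x 0 (0, 0, 0, 1) := by
    simpa [b₆] using W.bGrad_line l hx (0, 0, 0, 1)
  have hy : y = y.1 • ((1, 0, 0, 0) : ℝ × ℝ × ℝ × ℝ) + y.2.1 • ((0, 1, 0, 0) : ℝ × ℝ × ℝ × ℝ) +
      y.2.2.1 • ((0, 0, 1, 0) : ℝ × ℝ × ℝ × ℝ) + y.2.2.2 • ((0, 0, 0, 1) : ℝ × ℝ × ℝ × ℝ) := by
    simp
  rw [h3, h4, h5, h6]
  conv_lhs => rw [hy]
  simp only [map_add, map_smul, smul_eq_mul]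
  ring

/-- First-order Taylor expansion of `b(x,l,·)` at `0`, uniformly in `x`. -/
lemma b_taylor {ε : ℝ} (hε : 0 < ε) : ∃ ρ > 0, ∀ x ∈ Icc (0 : ℝ) 1, ∀ y : ℝ × ℝ × ℝ × ℝ, ‖y‖ ≤ ρ →
    |W.b x l y.1 y.2.1 y.2.2.1 y.2.2.2 -
      (W.b₃ x l * y.1 + W.b₄ x l * y.2.1 + W.b₅ x l * y.2.2.1 + W.b₆ x l * y.2.2.2)| ≤ ε * ‖y‖ := by
  have hK : IsCompact (Icc (0 : ℝ) 1 ×ˢ Metric.closedBall (0 : ℝ × ℝ × ℝ × ℝ) 1) :=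
    isCompact_Icc.prod (isCompact_closedBall 0 1)
  have hc : ContinuousOn (fun p : ℝ × ℝ × ℝ × ℝ × ℝ => W.bGrad l p.1 p.2)
      (Icc (0 : ℝ) 1 ×ˢ Metric.closedBall (0 : ℝ × ℝ × ℝ × ℝ) 1) :=
    W.continuousOn_bGrad.comp (f := fun p : ℝ × ℝ × ℝ × ℝ × ℝ => ((p.1, l), p.2)) (by fun_prop)
      (fun p hp => ⟨⟨hp.1, mem_univ _⟩, mem_univ _⟩)
  have hu := hK.uniformContinuousOn_of_continuous hc
  rw [Metric.uniformContinuousOn_iff] at hu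
  obtain ⟨ρ, hρ, hu⟩ := hu ε hε
  refine ⟨min (ρ / 2) 1, by positivity, fun x hx y hy => ?_⟩
  have hbound : ∀ z ∈ Metric.closedBall (0 : ℝ × ℝ × ℝ × ℝ) (min (ρ / 2) 1),
      ‖W.bGrad l x z - W.bGrad l x 0‖ ≤ ε := by
    intro z hz
    rw [mem_closedBall_zero_iff] at hz
    have h1 := hu (x, z) ⟨hx, mem_closedBall_zero_iff.2 (hz.trans (min_le_right _ _))⟩ (x, 0)
      ⟨hx, by simp⟩ (by
        rw [Prod.dist_eq, dist_self, dist_zero_right]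
        have := hz.trans (min_le_left _ _)
        exact max_lt hρ (by linarith))
    rw [dist_eq_norm] at h1
    exact h1.le
  have h := (convex_closedBall (0 : ℝ × ℝ × ℝ × ℝ) (min (ρ / 2) 1)
    ).norm_image_sub_le_of_norm_hasFDerivWithin_le'
    (fun z _ => (W.hasFDerivAt_b l hx z).hasFDerivWithinAt) hbound
    (Metric.mem_closedBall_self (by positivity)) (mem_closedBall_zero_iff.2 hy)
  rw [sub_zero, bGrad_zero_apply W l hx] at h
  have h0 := W.b_zero x hx l
  simpa [h0] using h

/-- The function `(v₁ - v₂) / (2a)` on the cylinder, the space derivative of `J v`. -/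
def halfDiff : CylPair →L[ℝ] CylFun :=
  mulX ((1 / 2 : ℝ) • W.slowness l) ∘L
    (ContinuousLinearMap.fst ℝ CylFun CylFun - ContinuousLinearMap.snd ℝ CylFun CylFun)

lemma halfDiff_apply (v : C2pi) (t : ℝ) (x : UnitI) :
    W.halfDiff l (cylEquiv v) ((t : Circ), x) = W.K l v t x := by
  change (1 / 2 : ℝ) * (1 / W.a x l) * (fstC v t x - sndC v t x) = _
  have := W.a_ne l x x.2
  rw [K]
  field_simp

lemma integrateX_halfDiff_apply (v : C2pi) (t : ℝ) (x : UnitI) :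
    integrateX (W.halfDiff l (cylEquiv v)) ((t : Circ), x) = W.J l v t x := by
  rw [integrateX_apply, J, ← intervalIntegral.integral_const_mul]
  refine intervalIntegral.integral_congr fun ξ hξ => ?_
  have hξ' : ξ ∈ Icc (0 : ℝ) 1 := uIcc_subset_Icc (by simp) x.2 hξ
  obtain ⟨ξ, rfl⟩ : ∃ z : UnitI, (z : ℝ) = ξ := ⟨⟨ξ, hξ'⟩, rfl⟩
  have := W.a_ne l ξ ξ.2
  simp only [clamp_coe]
  rw [halfDiff_apply, K]
  field_simp

/-- The part `b₃ (J v)(t,x) + b₄ (J v)(t + s,x)` of the linearized nonlinearity; the time delay of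
the equation is `s = -ωτ`. -/
def nonlocal (s : ℝ) : CylPair →L[ℝ] CylFun :=
  mulX (onUnit (fun x => W.b₃ x l) (W.b₃_cont l)) ∘L integrateX ∘L W.halfDiff l +
    mulX (onUnit (fun x => W.b₄ x l) (W.b₄_cont l)) ∘L (shift s ∘L integrateX) ∘L W.halfDiff l

/-- The linearization at `0` of `opB`, on the cylinder. -/
def linB (s : ℝ) : CylPair →L[ℝ] CylPair :=
  offDiag (mulX (onUnit (fun x => W.b₂ x l) (W.b₂_cont l)))
    (mulX (onUnit (fun x => W.b₁ x l) (W.b₁_cont l))) + (W.nonlocal l s).prod (W.nonlocal l s)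

lemma nonlocal_apply (s : ℝ) (v : C2pi) (t : ℝ) (x : UnitI) :
    W.nonlocal l s (cylEquiv v) ((t : Circ), x) =
      W.b₃ x l * W.J l v t x + W.b₄ x l * W.J l v (t + s) x := by
  rw [← integrateX_halfDiff_apply, ← integrateX_halfDiff_apply, AddCircle.coe_add]
  rfl

lemma c2pi_norm_le {v : C2pi} {M : ℝ} (h₁ : ∀ (t : ℝ) (x : UnitI), |fstC v t x| ≤ M)
    (h₂ : ∀ (t : ℝ) (x : UnitI), |sndC v t x| ≤ M) : ‖v‖ ≤ 2 * M := by
  have hM : 0 ≤ M := (abs_nonneg _).trans (h₁ 0 0)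
  change ‖v.1‖ ≤ _
  rw [BoundedContinuousFunction.norm_le (by positivity)]
  rintro ⟨t, x⟩
  have e₁ := h₁ t x
  have e₂ := h₂ t x
  rw [fstC, projIcc_val] at e₁
  rw [sndC, projIcc_val] at e₂
  rw [WithLp.prod_norm_eq_of_L1, two_mul]
  exact add_le_add e₁ e₂

lemma fstC_sub (v w : C2pi) (t x : ℝ) : fstC (v - w) t x = fstC v t x - fstC w t x := rfl

lemma sndC_sub (v w : C2pi) (t x : ℝ) : sndC (v - w) t x = sndC v t x - sndC w t x := rfl

lemma fstC_symm (z : CylPair) (t : ℝ) (x : UnitI) :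
    fstC (cylEquiv.symm z) t x = z.1 ((t : Circ), x) := by
  rw [← cylEquiv_fst, ContinuousLinearEquiv.apply_symm_apply]

lemma sndC_symm (z : CylPair) (t : ℝ) (x : UnitI) :
    sndC (cylEquiv.symm z) t x = z.2 ((t : Circ), x) := by
  rw [← cylEquiv_snd, ContinuousLinearEquiv.apply_symm_apply]

lemma fstC_opB (ω τ : ℝ) (v : C2pi) (t : ℝ) (x : UnitI) :
    fstC (W.opB ω τ l v) t x = W.B₁ v ω τ l t x := by
  change W.B₁ v ω τ l t (clamp x) = _
  rw [clamp_coe]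

lemma sndC_opB (ω τ : ℝ) (v : C2pi) (t : ℝ) (x : UnitI) :
    sndC (W.opB ω τ l v) t x = W.B₂ v ω τ l t x := by
  change W.B₂ v ω τ l t (clamp x) = _
  rw [clamp_coe]

lemma opB_zero (ω τ : ℝ) : W.opB ω τ l 0 = 0 := by
  have z1 : ∀ t x, fstC (0 : C2pi) t x = 0 := fun _ _ => rfl
  have z2 : ∀ t x, sndC (0 : C2pi) t x = 0 := fun _ _ => rfl
  have hB : ∀ t (x : UnitI), W.B 0 ω τ l t x = 0 := by
    intro t x
    simp [B, J, K, K₀, z1, z2, W.b_zero x x.2 l]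
  refine c2pi_ext (fun t x => ?_) (fun t x => ?_)
  · rw [fstC_opB, B₁, hB, z1]
    simp
  · rw [sndC_opB, B₂, hB, z2]
    simp

/-- The nonlinearity is a superposition operator composed with bounded linear operators, so that the
Taylor expansion `b_taylor`, uniform in `x`, gives its derivative at `0`. The diagonal terms of this
derivative cancel against the subtracted `b_j v_j`, which leaves `linB`. -/
theorem hasFDerivAt_opB (ω τ : ℝ) :
    HasFDerivAt (W.opB ω τ l)
      ((cylEquiv.symm : CylPair →L[ℝ] C2pi) ∘L W.linB l (-(ω * τ)) ∘L
        (cylEquiv : C2pi →L[ℝ] CylPair)) 0 := by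
  set M := ‖integrateX ∘L W.halfDiff l ∘L (cylEquiv : C2pi →L[ℝ] CylPair)‖ +
    ‖W.halfDiff l ∘L (cylEquiv : C2pi →L[ℝ] CylPair)‖ + 1 with hM
  have hM1 : 0 < M := by positivity
  have hJ : ∀ v t (x : UnitI), |W.J l v t x| ≤ M * ‖v‖ := fun v t x => by
    rw [← integrateX_halfDiff_apply]
    refine (abs_apply_le _ _).trans (((integrateX ∘L W.halfDiff l ∘L
      (cylEquiv : C2pi →L[ℝ] CylPair)).le_opNorm v).trans ?_)
    refine mul_le_mul_of_nonneg_right ?_ (norm_nonneg v)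
    rw [hM, add_assoc]
    exact le_add_of_nonneg_right (by positivity)
  have hKb : ∀ v t (x : UnitI), |W.K l v t x| ≤ M * ‖v‖ := fun v t x => by
    rw [← halfDiff_apply]
    refine (abs_apply_le _ _).trans (((W.halfDiff l ∘L
      (cylEquiv : C2pi →L[ℝ] CylPair)).le_opNorm v).trans ?_)
    refine mul_le_mul_of_nonneg_right ?_ (norm_nonneg v)
    rw [hM, add_right_comm]
    exact le_add_of_nonneg_left (by positivity)
  have hK0 : ∀ v t (x : UnitI), |K₀ v t x| ≤ M * ‖v‖ := fun v t x => by
    have h1 : |K₀ v t x| ≤ ‖v‖ := by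
      have e1 := abs_le.1 (fstC_le v t x)
      have e2 := abs_le.1 (sndC_le v t x)
      rw [K₀, abs_le]
      constructor <;> linarith
    refine h1.trans (le_mul_of_one_le_left (norm_nonneg v) ?_)
    rw [hM]
    exact le_add_of_nonneg_left (by positivity)
  rw [hasFDerivAt_iff_isLittleO_nhds_zero, Asymptotics.isLittleO_iff]
  intro c hc
  obtain ⟨ρ, hρ, hT⟩ := W.b_taylor l (ε := c / (2 * M)) (by positivity)
  filter_upwards [Metric.ball_mem_nhds (0 : C2pi) (show 0 < ρ / M by positivity)] with v hv
  rw [mem_ball_zero_iff, lt_div_iff₀ hM1] at hv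
  rw [zero_add, opB_zero, sub_zero]
  -- the pointwise remainder
  have hrem : ∀ t (x : UnitI),
      |W.b x l (W.J l v t x) (W.J l v (t - ω * τ) x) (K₀ v t x) (W.K l v t x) -
        (W.b₃ x l * W.J l v t x + W.b₄ x l * W.J l v (t - ω * τ) x + W.b₅ x l * K₀ v t x +
          W.b₆ x l * W.K l v t x)| ≤ c / 2 * ‖v‖ := by
    intro t x
    have hy : ‖((W.J l v t x, W.J l v (t - ω * τ) x, K₀ v t x, W.K l v t x) :
        ℝ × ℝ × ℝ × ℝ)‖ ≤ M * ‖v‖ :=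
      max_le (hJ v _ x) (max_le (hJ v _ x) (max_le (hK0 v t x) (hKb v t x)))
    refine (hT x x.2 _ (hy.trans (by linarith))).trans
      ((mul_le_mul_of_nonneg_left hy (by positivity)).trans_eq ?_)
    field_simp
  have hfin : c * ‖v‖ = 2 * (c / 2 * ‖v‖) := by ring
  rw [hfin]
  refine c2pi_norm_le (fun t x => ?_) (fun t x => ?_)
  · rw [fstC_sub, fstC_opB]
    change |_ - fstC (cylEquiv.symm _) t x| ≤ _
    rw [fstC_symm]
    change |_ - (W.b₂ x l * sndC v t x + W.nonlocal l (-(ω * τ)) (cylEquiv v) ((t : Circ), x))| ≤ _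
    rw [nonlocal_apply, ← sub_eq_add_neg]
    convert hrem t x using 2
    have := W.a_ne l x x.2
    simp only [B₁, B, b₁, b₂, K, K₀]
    field_simp
    ring
  · rw [sndC_sub, sndC_opB]
    change |_ - sndC (cylEquiv.symm _) t x| ≤ _
    rw [sndC_symm]
    change |_ - (W.b₁ x l * fstC v t x + W.nonlocal l (-(ω * τ)) (cylEquiv v) ((t : Circ), x))| ≤ _
    rw [nonlocal_apply, ← sub_eq_add_neg]
    convert hrem t x using 2
    have := W.a_ne l x x.2
    simp only [B₂, B, b₁, b₂, K, K₀]
    field_simp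
    ring

end WaveData

/-! ### The Fredholm property of the linearization -/

namespace WaveData

variable (W : WaveData) (l : ℝ)

/-- The factors collected along one round trip multiply to `exp (∫ b₅ / a)`. -/
lemma growth_mul_growth :
    W.growth₁ l 1 * W.growth₂ l 1 = Real.exp (∫ x in (0 : ℝ)..1, W.b₅ x l / W.a x l) := by
  have h : ∀ {g : ℝ → ℝ} (hg : ContinuousOn g (Icc (0 : ℝ) 1)),
      primitive (onUnit g hg) 1 = ∫ x in (0 : ℝ)..1, g x := fun hg => by
    have := integral_eq_primitive_sub hg 1 0
    rw [primitive_zero, sub_zero] at this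
    exact this.symm
  rw [growth₁, growth₂, expPrimitive_apply, expPrimitive_apply, ← Real.exp_add, h, h,
    ← intervalIntegral.integral_add]
  · congr 1
    refine intervalIntegral.integral_congr fun x hx => ?_
    have := W.a_ne l x (by simpa using hx)
    simp only [b₁, b₂]
    field_simp
    ring
  · exact ((W.b₁_div_a_cont l).mono (by simp)).intervalIntegrable
  · exact ((W.b₂_div_a_cont l).mono (by simp)).intervalIntegrable

lemma continuous_integral_b₅ :
    Continuous fun l : ℝ => ∫ x in (0 : ℝ)..1, W.b₅ x l / W.a x l := by
  have hcl := continuous_clamp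
  have hb : Continuous fun p : ℝ × ℝ => W.b₅ (clamp p.2) p.1 := by
    have h1 : Continuous fun p : ℝ × ℝ => W.bGrad p.1 (clamp p.2) 0 (0, 0, 1, 0) :=
      (W.continuousOn_bGrad.comp_continuous
        (f := fun p : ℝ × ℝ => (((clamp p.2 : ℝ), p.1), (0 : ℝ × ℝ × ℝ × ℝ))) (by fun_prop)
        (fun p => ⟨⟨(clamp p.2).2, mem_univ _⟩, mem_univ _⟩)).clm_apply continuous_const
    refine h1.congr fun p => ?_
    rw [bGrad_zero_apply W p.1 (clamp p.2).2]
    simp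
  have ha : Continuous fun p : ℝ × ℝ => W.a (clamp p.2) p.1 :=
    W.a_smooth.continuousOn.comp_continuous
      (f := fun p : ℝ × ℝ => ((clamp p.2 : ℝ), p.1)) (by fun_prop)
      (fun p => ⟨(clamp p.2).2, mem_univ _⟩)
  have h := intervalIntegral.continuous_parametric_intervalIntegral_of_continuous
    (μ := MeasureTheory.volume) (a₀ := 0)
    (f := fun l x => W.b₅ (clamp x) l / W.a (clamp x) l)
    (hb.div ha fun p => W.a_ne p.1 _ (clamp p.2).2) (continuous_const (y := (1 : ℝ)))
  refine h.congr fun l => ?_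
  refine intervalIntegral.integral_congr fun x hx => ?_
  have hx' : x ∈ Icc (0 : ℝ) 1 := by simpa using hx
  simp only [clamp, projIcc_of_mem zero_le_one hx']

lemma cylEquiv_linearization (ω τ : ℝ) (v : C2pi) :
    cylEquiv (W.linearization ω τ l v) =
      (1 - offDiag (reflectLeft (W.slowness l) (W.leftFactor l) ω)
          (reflectRight (W.slowness l) (W.rightFactor l) ω) -
        ((sweepLeft (W.slowness l) (W.leftFactor l) (W.leftDensity l) ω).prodMap
          (sweepRight (W.slowness l) (W.growth₂ l) (W.rightDensity l) ω)) ∘L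
          W.linB l (-(ω * τ))) (cylEquiv v) := by
  have e : W.linearization ω τ l v = v - W.opC ω l v -
      W.opD ω l (cylEquiv.symm (W.linB l (-(ω * τ)) (cylEquiv v))) := by
    rw [linearization, (W.hasFDerivAt_opB l ω τ).fderiv]
    rfl
  rw [e, map_sub, map_sub, cylEquiv_opC, cylEquiv_opD, ContinuousLinearEquiv.apply_symm_apply]
  rfl

/-- The two reflections of a round trip multiply to `-exp (-∫ b₅ / a)`, whose absolute value differs
from `1` exactly if the integral does not vanish. -/
theorem fredholm_linearization {ω : ℝ} (hω : ω ≠ 0) (τ : ℝ)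
    (h : (∫ x in (0 : ℝ)..1, W.b₅ x l / W.a x l) ≠ 0) :
    (W.linearization ω τ l).IsFredholm ∧ fredholmIndex (W.linearization ω τ l) = 0 := by
  set q := (W.growth₂ l 1)⁻¹ * (W.growth₁ l 1)⁻¹ with hq
  have hq0 : 0 < q := mul_pos (inv_pos.2 (W.growth₂_pos l 1)) (inv_pos.2 (W.growth₁_pos l 1))
  have hq1 : q ≠ 1 := by
    rw [hq, ← mul_inv, mul_comm, growth_mul_growth, ne_eq, inv_eq_one, Real.exp_eq_one_iff]
    exact h
  have hqe : W.rightFactor l 0 * W.leftFactor l 1 = -q := by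
    change (W.growth₂ l 1)⁻¹ * W.growth₂ l 0 * -(W.growth₁ l 1)⁻¹ = -q
    rw [show W.growth₂ l 0 = 1 from expPrimitive_zero _, hq]
    ring
  obtain ⟨Q, K, ⟨u, rfl⟩, hK, hQK⟩ := exists_isUnit_sub_compact (W.slowness_pos l) hω
    (W.leftFactor l) (W.rightFactor l) (W.growth₂ l) (W.leftDensity l) (W.rightDensity l)
    (onUnit (fun x => W.b₁ x l) (W.b₁_cont l)) (onUnit (fun x => W.b₂ x l) (W.b₂_cont l))
    (onUnit (fun x => W.b₃ x l) (W.b₃_cont l)) (onUnit (fun x => W.b₄ x l) (W.b₄_cont l))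
    (-(ω * τ)) (W.halfDiff l) hq0 hq1 hqe (N := W.nonlocal l (-(ω * τ))) rfl
  have key : W.linearization ω τ l =
      ((cylEquiv.trans (ContinuousLinearEquiv.ofUnit u)).trans cylEquiv.symm : C2pi →L[ℝ] C2pi) -
        (cylEquiv.symm : CylPair →L[ℝ] C2pi) ∘L K ∘L (cylEquiv : C2pi →L[ℝ] CylPair) := by
    refine ContinuousLinearMap.ext fun v => cylEquiv.injective ?_
    have h1 := W.cylEquiv_linearization l ω τ v
    rw [linB, hQK] at h1
    rw [h1]
    change u.1 (cylEquiv v) - K (cylEquiv v) =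
      cylEquiv (cylEquiv.symm (u.1 (cylEquiv v)) - cylEquiv.symm (K (cylEquiv v)))
    rw [map_sub, ContinuousLinearEquiv.apply_symm_apply, ContinuousLinearEquiv.apply_symm_apply]
  rw [key]
  exact fredholm_of_sub_compact _ ((hK.comp_clm (cylEquiv : C2pi →L[ℝ] CylPair)).clm_comp
    (cylEquiv.symm : CylPair →L[ℝ] C2pi))

end WaveData

end WaveHopf

end

theorem lemma4p1 (W : WaveHopf.WaveData)
    (h : (∫ x in (0 : ℝ)..1, W.b₅ x 0 / W.a x 0) ≠ 0) :
    ∃ δ : ℝ, 0 < δ ∧ ∀ ω τ l : ℝ, ω ≠ 0 → |l| < δ →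
      DifferentiableAt ℝ (W.opB ω τ l) 0 ∧
      (W.linearization ω τ l).IsFredholm ∧
      WaveHopf.fredholmIndex (W.linearization ω τ l) = 0 := by
  obtain ⟨δ, hδ, hball⟩ := Metric.eventually_nhds_iff.1
    (W.continuous_integral_b₅.continuousAt.eventually_ne h)
  refine ⟨δ, hδ, fun ω τ l hω hl => ⟨(W.hasFDerivAt_opB l ω τ).differentiableAt, ?_⟩⟩
  exact W.fredholm_linearization l hω τ (hball (by simpa [Real.dist_eq] using hl))
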